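/- **Theorem 1 (No efficient single-client state verification with fixed number of rounds).** Let $n\ge 2$ and $N\ge 1$ be integers, $I=\mathbb{C}$ the trivial algebra, and let $\phi$ be a density operator on $\mathbb{C}^n$ (the target state). A *channel* is a completely positive trace preserving map between finite-dimensional C*-algebras. A *$p$-comb* with holes $(A_i,B_i)_{i=1}^p$ from $C$ to $D$ is a tuple of channels $g_0:C\to A_1\otimes Y_1$, $g_i:B_i\otimes Y_i\to A_{i+1}\otimes Y_{i+1}$ $(1\le i<p)$, $g_p:B_p\otimes Y_p\to D$ with arbitrary memories $Y_i$ (for $p=0$: one channel $C\to D$). A two-party protocol consists of a comb for the client and a comb for the source; it is applied to bipartite channels by tensoring the two combs and filling the $i$-th joint hole with the $i$-th channel that the protocol calls. *Ideal resource.* $\mathcal{S}_\phi : I\otimes(I\oplus I)\to (M_n(\mathbb{C})\oplus I)\otimes I$ takes a bit $c$ from the source; if $c=0$ the client receives $\phi$ (in the summand $M_n(\mathbb{C})$), if $c=1$ the client receives the abort signal (in the summand $I$). The filter $\sharp$ inputs $c=0$ on behalf of the source, so $\sharp(\mathcal{S}_\phi)$ always outputs $\phi$. *Simple protocol.* Let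 $\eta$ be a probability distribution on $\{1,\dots,N+1\}$ and $\mu: M_n(\mathbb{C})^{\otimes N}\to I\oplus I$ a two-outcome measurement. In the simple protocol $\pi$, applied to $N+1$ copies $\bar a=(\mathcal{Q},\dots,\mathcal{Q})$ of the noiseless quantum channel from the source to the client, the source prepares $\phi^{\otimes(N+1)}$ and sends the $N+1$ registers one after the other; the client samples $r$ from $\eta$, moves the $r$-th received register behind all the others (and forgets $r$), measures the first $N$ registers with $\mu$, outputs the remaining register if the result is $0$, and outputs the abort signal if it is $1$. *Attacks.* For a protocol $\pi$, $\mathcal{A}(\pi)$ is the set of all protocols obtained from $\pi$ by replacing the comb of the source by an arbitrary comb with the same holes (its outer input and output may change as well); the client's comb is unchanged. For a density operator $\rho$, $A_\rho\in\mathcal{A}(\pi)$ is the i.i.d. attack in which the source prepares and sends $N+1$ copies of $\rho$ instead of $\phi$; its source has trivial input and output. A simulator attack is a $B\in\mathcal{A}(\mathrm{id})$, where $\mathrm{id}$ is the identity protocol on the type of $\mathcal{S}_\phi$, with the same (trivial) source input and output. *Claim.* Let $\diamond(\Phi,\Psi)=\|\Phi-\Psi\|_\diamond$ be the diamond distance.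 For every $\phi$, $\eta$ and $\mu$ as above there is a density operator $\rho$ on $\mathbb{C}^n$ such that $A_\rho\in\mathcal{A}(\pi)$ and, for every simulator attack $B$ on the ideal resource, $$\tfrac12\,\diamond\bigl(\pi(\bar a),\ \sharp(\mathcal{S}_\phi)\bigr)+\tfrac12\,\diamond\bigl(A_\rho(\bar a),\ B(\mathcal{S}_\phi)\bigr)\ \ge\ \varepsilon,$$ where $\varepsilon=\dfrac{1}{27N}$ if $\phi$ is mixed (i.e. not pure) and $\varepsilon=\dfrac{1}{8\sqrt N}$ if $\phi$ is pure. -/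

import Mathlib

noncomputable section

namespace QSV

open Matrix
open scoped ComplexOrder

/-! ### Finite-dimensional C*-algebras and quantum channels -/

/-- A finite-dimensional C*-algebra `⨁ᵢ M_{β i}(ℂ)`, presented by the finite index set `ι` of its
matrix blocks and, for every block, a finite set `β i` indexing its rows and columns. -/
structure Sys : Type 1 where
  ι : Type
  β : ι → Type
  [finι : Fintype ι]
  [finβ : ∀ i, Fintype (β i)]

attribute [instance] Sys.finι Sys.finβ

/-- The elements of the algebra: one square complex matrix for each block. -/
abbrev Sys.Op (A : Sys) : Type := ∀ i, Matrix (A.β i) (A.β i) ℂ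

/-- Positivity in the algebra. -/
def Sys.Pos (A : Sys) (X : A.Op) : Prop := ∀ i, (X i).PosSemidef

/-- The trace of the algebra. -/
def Sys.tr (A : Sys) (X : A.Op) : ℂ := ∑ i, (X i).trace

/-- The full matrix algebra with rows and columns indexed by `d`. -/
abbrev Sys.mat (d : Type) [Fintype d] : Sys where
  ι := Unit
  β := fun _ => d

/-- The tensor unit `I = ℂ`. -/
abbrev Sys.unit : Sys := Sys.mat Unit

/-- The tensor product of algebras. -/
abbrev Sys.tensor (A B : Sys) : Sys where
  ι := A.ι × B.ι
  β := fun p => A.β p.1 × B.β p.2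

/-- The direct sum of two algebras. -/
abbrev Sys.sum (A B : Sys) : Sys where
  ι := A.ι ⊕ B.ι
  β := Sum.elim A.β B.β
  finβ := fun s => by
    cases s
    · exact A.finβ _
    · exact B.finβ _

/-- The `n`-fold direct sum `A ⊕ ⋯ ⊕ A`. -/
abbrev Sys.copies (n : ℕ) (A : Sys) : Sys where
  ι := Fin n × A.ι
  β := fun p => A.β p.2

infixr:70 " ⊗ₛ " => Sys.tensor
infixr:65 " ⊕ₛ " => Sys.sum

/-- The map `L ⊗ id_C`. -/
def tensorIdMap {A B : Sys} (L : A.Op →ₗ[ℂ] B.Op) (C : Sys) :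
    (A ⊗ₛ C).Op →ₗ[ℂ] (B ⊗ₛ C).Op where
  toFun X := fun p => Matrix.of fun b b' =>
    L (fun i => Matrix.of fun a a' => X (i, p.2) (a, b.2) (a', b'.2)) p.1 b.1 b'.1
  map_add' X Y := by
    funext p
    ext b b'
    exact congrFun (congrFun (congrFun (L.map_add
      (fun i => Matrix.of fun a a' => X (i, p.2) (a, b.2) (a', b'.2))
      (fun i => Matrix.of fun a a' => Y (i, p.2) (a, b.2) (a', b'.2))) p.1) b.1) b'.1
  map_smul' c X := by
    funext p
    ext b b'
    exact congrFun (congrFun (congrFun (L.map_smul c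
      (fun i => Matrix.of fun a a' => X (i, p.2) (a, b.2) (a', b'.2))) p.1) b.1) b'.1

/-- Quantum channels (completely positive trace preserving maps): the morphisms of the category
`CPTP`. Complete positivity is positivity of `L ⊗ id` for every finite-dimensional ancilla. -/
structure Chan (A B : Sys) where
  map : A.Op →ₗ[ℂ] B.Op
  cp : ∀ (κ : Type) [Fintype κ] (X : (A ⊗ₛ Sys.mat κ).Op),
    (A ⊗ₛ Sys.mat κ).Pos X → (B ⊗ₛ Sys.mat κ).Pos (tensorIdMap map (Sys.mat κ) X)
  tp : ∀ X : A.Op, B.tr (map X) = A.tr X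

/-- Sequential composition: `g.comp f` is `f` followed by `g`. -/
def Chan.comp {A B C : Sys} (g : Chan B C) (f : Chan A B) : Chan A C where
  map := g.map ∘ₗ f.map
  cp κ _ X hX := g.cp κ _ (f.cp κ X hX)
  tp X := (g.tp _).trans (f.tp X)

/-- The structural isomorphism given by a bijection `e` between the blocks of two algebras and
bijections `f` between the index sets of corresponding blocks. -/
def Chan.relabel {A B : Sys} (e : B.ι ≃ A.ι) (f : ∀ j, B.β j ≃ A.β (e j)) : Chan A B where
  map :=
    { toFun := fun X j => (X (e j)).submatrix (f j) (f j)
      map_add' := fun _ _ => rfl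
      map_smul' := fun _ _ => rfl }
  cp κ _ X hX := fun p => (hX (e p.1, p.2)).submatrix (Prod.map (f p.1) id)
  tp X := by
    refine (Finset.sum_congr rfl fun j _ => ?_).trans (Equiv.sum_comp e fun i => (X i).trace)
    exact Equiv.sum_comp (f j) fun a => X (e j) a a

/-- The identity channel. -/
def Chan.id (A : Sys) : Chan A A := Chan.relabel (Equiv.refl _) fun _ => Equiv.refl _

/-- The symmetry `A ⊗ B → B ⊗ A`. -/
def Chan.swap (A B : Sys) : Chan (A ⊗ₛ B) (B ⊗ₛ A) :=
  Chan.relabel (Equiv.prodComm _ _) fun _ => Equiv.prodComm _ _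

/-- The interchange of the two middle factors. -/
def Chan.midSwap (A B C D : Sys) :
    Chan ((A ⊗ₛ B) ⊗ₛ (C ⊗ₛ D)) ((A ⊗ₛ C) ⊗ₛ (B ⊗ₛ D)) :=
  Chan.relabel (Equiv.prodProdProdComm _ _ _ _) fun _ => Equiv.prodProdProdComm _ _ _ _

/-- The left unitor `I ⊗ A → A`. -/
def Chan.lunit (A : Sys) : Chan (Sys.unit ⊗ₛ A) A :=
  Chan.relabel (A := Sys.unit ⊗ₛ A) (B := A) (Equiv.uniqueProd _ Unit).symm
    fun _ => (Equiv.uniqueProd _ Unit).symm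

/-- The inverse left unitor `A → I ⊗ A`. -/
def Chan.lunitInv (A : Sys) : Chan A (Sys.unit ⊗ₛ A) :=
  Chan.relabel (A := A) (B := Sys.unit ⊗ₛ A) (Equiv.uniqueProd _ Unit)
    fun _ => Equiv.uniqueProd _ Unit

/-- The right unitor `A ⊗ I → A`. -/
def Chan.runit (A : Sys) : Chan (A ⊗ₛ Sys.unit) A := (Chan.lunit A).comp (Chan.swap A Sys.unit)

/-- The inverse right unitor `A → A ⊗ I`. -/
def Chan.runitInv (A : Sys) : Chan A (A ⊗ₛ Sys.unit) :=
  (Chan.swap Sys.unit A).comp (Chan.lunitInv A)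

/-- The channel `Φ ⊗ id_C`. -/
def Chan.tensorId {A B : Sys} (Φ : Chan A B) (C : Sys) : Chan (A ⊗ₛ C) (B ⊗ₛ C) where
  map := tensorIdMap Φ.map C
  cp κ _ X hX := fun p => by
    have h := Φ.cp (C.β p.1.2 × κ)
      (fun q => (X ((q.1, p.1.2), p.2)).submatrix
        (fun x : A.β q.1 × (C.β p.1.2 × κ) => ((x.1, x.2.1), x.2.2))
        (fun x : A.β q.1 × (C.β p.1.2 × κ) => ((x.1, x.2.1), x.2.2)))
      (fun q => (hX ((q.1, p.1.2), p.2)).submatrix _) (p.1.1, ())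
    exact h.submatrix
      (fun y : (B.β p.1.1 × C.β p.1.2) × κ => (y.1.1, (y.1.2, y.2)))
  tp X := by
    have h : ∀ (k : C.ι) (c : C.β k),
        ∑ j, ∑ b, Φ.map (fun i => Matrix.of fun a a' => X (i, k) (a, c) (a', c)) j b b
          = ∑ i, ∑ a, X (i, k) (a, c) (a, c) := fun k c =>
      Φ.tp (fun i => Matrix.of fun a a' => X (i, k) (a, c) (a', c))
    have l : (B ⊗ₛ C).tr (tensorIdMap Φ.map C X) = ∑ k, ∑ c, ∑ j, ∑ b,
        Φ.map (fun i => Matrix.of fun a a' => X (i, k) (a, c) (a', c)) j b b := by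
      refine (Fintype.sum_prod_type_right _).trans (Finset.sum_congr rfl fun k _ => ?_)
      rw [Finset.sum_comm]
      exact Finset.sum_congr rfl fun j _ => Fintype.sum_prod_type_right _
    have r : (A ⊗ₛ C).tr X = ∑ k, ∑ c, ∑ i, ∑ a, X (i, k) (a, c) (a, c) := by
      refine (Fintype.sum_prod_type_right _).trans (Finset.sum_congr rfl fun k _ => ?_)
      rw [Finset.sum_comm]
      exact Finset.sum_congr rfl fun j _ => Fintype.sum_prod_type_right _
    rw [l, r]
    exact Finset.sum_congr rfl fun k _ => Finset.sum_congr rfl fun c _ => h k c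

/-- The tensor product of channels. -/
def Chan.tensor {A B C D : Sys} (Φ : Chan A B) (Ψ : Chan C D) : Chan (A ⊗ₛ C) (B ⊗ₛ D) :=
  (((Chan.swap D B).comp (Ψ.tensorId B)).comp (Chan.swap B C)).comp (Φ.tensorId C)

/-- The trace `A → I`. -/
def Chan.discard (A : Sys) : Chan A Sys.unit where
  map :=
    { toFun := fun X _ => Matrix.of fun _ _ => A.tr X
      map_add' := fun X Y => by
        funext i
        ext a b
        simp [Sys.tr, Finset.sum_add_distrib]
      map_smul' := fun c X => by
        funext i
        ext a b
        simp [Sys.tr, Finset.mul_sum] }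
  cp κ _ X hX := fun p => by
    have h : (∑ i, ∑ a : A.β i, (X (i, ())).submatrix
        (fun y : Unit × κ => (a, y.2)) (fun y : Unit × κ => (a, y.2))).PosSemidef :=
      Matrix.posSemidef_sum _ fun i _ => Matrix.posSemidef_sum _ fun a _ =>
        (hX (i, ())).submatrix _
    refine (congrArg Matrix.PosSemidef (Matrix.ext fun y y' => ?_)).mp h
    rw [Matrix.sum_apply]
    exact Finset.sum_congr rfl fun i _ => Matrix.sum_apply _ _ _ _
  tp X := by
    change ∑ _ : Unit, ∑ _ : Unit, A.tr X = A.tr X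
    simp

/-- Density operators: positive elements of trace one. -/
structure State (A : Sys) where
  op : A.Op
  pos : A.Pos op
  tr_eq_one : A.tr op = 1

/-- The channel `I → A` preparing the state `ρ`. -/
def Chan.prep {A : Sys} (ρ : State A) : Chan Sys.unit A where
  map :=
    { toFun := fun X i => X () () () • ρ.op i
      map_add' := fun X Y => by
        funext i
        exact add_smul _ _ _
      map_smul' := fun c X => by
        funext i
        exact mul_smul c _ _ }
  cp κ _ X hX := fun p => by
    have h := ((ρ.pos p.1).kronecker ((hX ((), ())).submatrix (fun k : κ => ((), k))))
    exact (congrArg Matrix.PosSemidef (Matrix.ext fun y y' => mul_comm _ _)).mp h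
  tp X := by
    change ∑ i, (X () () () • ρ.op i).trace = ∑ _ : Unit, ∑ _ : Unit, X () () ()
    have h : ∑ i, (ρ.op i).trace = 1 := ρ.tr_eq_one
    simp only [Matrix.trace_smul, ← Finset.smul_sum, h]
    simp

/-- The direct sum `Φ ⊕ Ψ` of channels. -/
def Chan.sumMap {A B C D : Sys} (Φ : Chan A C) (Ψ : Chan B D) :
    Chan (A ⊕ₛ B) (C ⊕ₛ D) where
  map :=
    { toFun := fun X s => match s with
        | Sum.inl j => Φ.map (fun i => X (Sum.inl i)) j
        | Sum.inr j => Ψ.map (fun i => X (Sum.inr i)) j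
      map_add' := fun X Y => by
        funext s
        cases s with
        | inl j => exact congrFun (Φ.map.map_add (fun i => X (Sum.inl i)) fun i => Y (Sum.inl i)) j
        | inr j => exact congrFun (Ψ.map.map_add (fun i => X (Sum.inr i)) fun i => Y (Sum.inr i)) j
      map_smul' := fun c X => by
        funext s
        cases s with
        | inl j => exact congrFun (Φ.map.map_smul c fun i => X (Sum.inl i)) j
        | inr j => exact congrFun (Ψ.map.map_smul c fun i => X (Sum.inr i)) j }
  cp κ _ X hX := fun p => by
    obtain ⟨s, u⟩ := p
    cases s with
    | inl j => exact Φ.cp κ (fun q => X (Sum.inl q.1, q.2)) (fun q => hX (Sum.inl q.1, q.2)) (j, u)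
    | inr j => exact Ψ.cp κ (fun q => X (Sum.inr q.1, q.2)) (fun q => hX (Sum.inr q.1, q.2)) (j, u)
  tp X := by
    refine (Fintype.sum_sum_type _).trans (Eq.trans ?_ (Fintype.sum_sum_type _).symm)
    exact congrArg₂ (· + ·) (Φ.tp fun i => X (Sum.inl i)) (Ψ.tp fun i => X (Sum.inr i))

/-- The direct sum `⨁ₖ Φₖ` of a family of channels `A → B`. -/
def Chan.copiesMap {n : ℕ} {A B : Sys} (Φ : Fin n → Chan A B) :
    Chan (Sys.copies n A) (Sys.copies n B) where
  map :=
    { toFun := fun X p => (Φ p.1).map (fun i => X (p.1, i)) p.2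
      map_add' := fun X Y => by
        funext p
        exact congrFun ((Φ p.1).map.map_add (fun i => X (p.1, i)) fun i => Y (p.1, i)) p.2
      map_smul' := fun c X => by
        funext p
        exact congrFun ((Φ p.1).map.map_smul c fun i => X (p.1, i)) p.2 }
  cp κ _ X hX := fun p =>
    (Φ p.1.1).cp κ (fun q => X ((p.1.1, q.1), q.2)) (fun q => hX ((p.1.1, q.1), q.2)) (p.1.2, p.2)
  tp X := by
    refine (Fintype.sum_prod_type _).trans (Eq.trans ?_ (Fintype.sum_prod_type _).symm)
    exact Finset.sum_congr rfl fun k _ => (Φ k).tp fun i => X (k, i)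

/-! ### Branching -/

/-- Branch-up `I^{⊕n} ⊗ A → A^{⊕n}`. -/
def Chan.branchUp (n : ℕ) (A : Sys) :
    Chan (Sys.copies n Sys.unit ⊗ₛ A) (Sys.copies n A) :=
  Chan.relabel (A := Sys.copies n Sys.unit ⊗ₛ A) (B := Sys.copies n A)
    ((Equiv.prodUnique (Fin n) Unit).symm.prodCongr (Equiv.refl A.ι))
    fun _ => (Equiv.uniqueProd _ Unit).symm

/-- Branch-down `A^{⊕n} → I^{⊕n} ⊗ A`. -/
def Chan.branchDown (n : ℕ) (A : Sys) :
    Chan (Sys.copies n A) (Sys.copies n Sys.unit ⊗ₛ A) :=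
  Chan.relabel (A := Sys.copies n A) (B := Sys.copies n Sys.unit ⊗ₛ A)
    ((Equiv.prodUnique (Fin n) Unit).prodCongr (Equiv.refl A.ι))
    fun _ => Equiv.uniqueProd _ Unit

/-- The if-else-if channel `I^{⊕n} ⊗ A → B^{⊕n}` that applies `Φ k` in branch `k`. -/
def Chan.elif {n : ℕ} {A B : Sys} (Φ : Fin n → Chan A B) :
    Chan (Sys.copies n Sys.unit ⊗ₛ A) (Sys.copies n B) :=
  (Chan.copiesMap Φ).comp (Chan.branchUp n A)

/-- Forgetting the branch, `A^{⊕n} → A`. -/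
def Chan.forgetBranch (n : ℕ) (A : Sys) : Chan (Sys.copies n A) A :=
  ((Chan.lunit A).comp ((Chan.discard (Sys.copies n Sys.unit)).tensorId A)).comp
    (Chan.branchDown n A)

/-- A classical bit `I ⊕ I`; the value `0` is the left summand. -/
abbrev Sys.bit : Sys := Sys.unit ⊕ₛ Sys.unit

/-- The two-fold branch-up `(I ⊕ I) ⊗ A → A ⊕ A`. -/
def Chan.branchUp₂ (A : Sys) : Chan (Sys.bit ⊗ₛ A) (A ⊕ₛ A) :=
  Chan.relabel (A := Sys.bit ⊗ₛ A) (B := A ⊕ₛ A)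
    { toFun := Sum.elim (fun i => (Sum.inl (), i)) (fun i => (Sum.inr (), i))
      invFun := fun p => match p with
        | (Sum.inl _, i) => Sum.inl i
        | (Sum.inr _, i) => Sum.inr i
      left_inv := by rintro (i | i) <;> rfl
      right_inv := by rintro ⟨i | i, j⟩ <;> rfl }
    fun s => match s with
      | Sum.inl _ => (Equiv.uniqueProd _ Unit).symm
      | Sum.inr _ => (Equiv.uniqueProd _ Unit).symm

/-- The if-else channel `(I ⊕ I) ⊗ A → B ⊕ C`: apply `Φ` if the bit is `0` and `Ψ` otherwise. -/
def Chan.ife {A B C : Sys} (Φ : Chan A B) (Ψ : Chan A C) : Chan (Sys.bit ⊗ₛ A) (B ⊕ₛ C) :=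
  (Chan.sumMap Φ Ψ).comp (Chan.branchUp₂ A)

/-- The classical bit with value `0`. -/
def State.zero : State Sys.bit where
  op := fun s => match s with
    | Sum.inl _ => (1 : Matrix Unit Unit ℂ)
    | Sum.inr _ => (0 : Matrix Unit Unit ℂ)
  pos := by
    rintro (i | i)
    · exact (Matrix.PosSemidef.one : (1 : Matrix Unit Unit ℂ).PosSemidef)
    · exact (Matrix.PosSemidef.zero : (0 : Matrix Unit Unit ℂ).PosSemidef)
  tr_eq_one := by
    refine (Fintype.sum_sum_type _).trans ?_
    change ∑ _ : Unit, (1 : Matrix Unit Unit ℂ).trace +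
      ∑ _ : Unit, (0 : Matrix Unit Unit ℂ).trace = 1
    simp

/-! ### Trace norm and diamond distance -/

open Classical in
/-- The trace norm `Tr √(X X†)` of a matrix. -/
def matTraceNorm {d : Type} [Fintype d] (X : Matrix d d ℂ) : ℝ :=
  ∑ i, √((isHermitian_mul_conjTranspose_self X).eigenvalues i)

/-- The trace norm in a finite-dimensional C*-algebra. -/
def Sys.traceNorm (A : Sys) (X : A.Op) : ℝ := ∑ i, matTraceNorm (X i)

/-- The induced trace norm: the maximum over density operators of the trace norm of the image. -/
def inducedTraceNorm {A B : Sys} (L : A.Op →ₗ[ℂ] B.Op) : ℝ :=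
  sSup (Set.range fun ρ : State A => B.traceNorm (L ρ.op))

/-- The diamond norm. -/
def diamondNorm {A B : Sys} (L : A.Op →ₗ[ℂ] B.Op) : ℝ := inducedTraceNorm (tensorIdMap L A)

/-- The diamond distance of two channels. -/
def diamondDist {A B : Sys} (Φ Ψ : Chan A B) : ℝ := diamondNorm (Φ.map - Ψ.map)

/-! ### Combs, protocols and the attack model -/

/-- One party's part of a protocol with `p` rounds: a tuple `(g₀, …, g_p)` of channels
`g₀ : C → A₁ ⊗ Y₁`, `gᵢ : Bᵢ ⊗ Yᵢ → Aᵢ₊₁ ⊗ Yᵢ₊₁`, `g_p : B_p ⊗ Y_p → D`, where the memories `Yᵢ`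
are arbitrary and `(Aᵢ, Bᵢ)` are the holes. -/
inductive Comb : (p : ℕ) → (Fin p → Sys) → (Fin p → Sys) → Sys → Sys → Type 1
  | done {A B : Fin 0 → Sys} {C D : Sys} (g : Chan C D) : Comb 0 A B C D
  | step {p : ℕ} {A B : Fin (p + 1) → Sys} {C D : Sys} (Y : Sys) (g : Chan C (A 0 ⊗ₛ Y))
      (rest : Comb p (Fin.tail A) (Fin.tail B) (B 0 ⊗ₛ Y) D) : Comb (p + 1) A B C D

/-- The channel obtained from the parallel composition of the combs of two parties by filling the
`i`-th hole with the bipartite channel `f i`. -/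
def Comb.fill : {p : ℕ} → {A₁ A₂ B₁ B₂ : Fin p → Sys} → {C₁ C₂ D₁ D₂ : Sys} →
    (∀ i, Chan (A₁ i ⊗ₛ A₂ i) (B₁ i ⊗ₛ B₂ i)) →
    Comb p A₁ B₁ C₁ D₁ → Comb p A₂ B₂ C₂ D₂ → Chan (C₁ ⊗ₛ C₂) (D₁ ⊗ₛ D₂)
  | _, _, _, _, _, _, _, _, _, _, .done g, .done h => g.tensor h
  | _, A₁, A₂, B₁, B₂, _, _, _, _, f, .step Y g rest, .step Z h rest' =>
    (Comb.fill (fun i => f i.succ) rest rest').comp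
      ((Chan.midSwap (B₁ 0) (B₂ 0) Y Z).comp
        (((f 0).tensorId (Y ⊗ₛ Z)).comp
          ((Chan.midSwap (A₁ 0) Y (A₂ 0) Z).comp (g.tensor h))))

/-- The type of a bipartite resource: inputs and outputs of the client and of the source. -/
structure ResType : Type 1 where
  clientIn : Sys
  sourceIn : Sys
  clientOut : Sys
  sourceOut : Sys

/-- A resource of a given type is a bipartite channel. -/
abbrev ResType.Res (T : ResType) : Type :=
  Chan (T.clientIn ⊗ₛ T.sourceIn) (T.clientOut ⊗ₛ T.sourceOut)

/-- The resource type in which the input and output of the source have been changed. -/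
abbrev ResType.withSource (T : ResType) (C D : Sys) : ResType := ⟨T.clientIn, C, T.clientOut, D⟩

/-- A protocol converting the resources of types `R 1, …, R l` into one of type `T`: it makes use
of `p` of these resources in the order given by the injection `sel`, and consists of a comb for
the client and a comb for the source. -/
structure Protocol {l : ℕ} (R : Fin l → ResType) (T : ResType) : Type 1 where
  p : ℕ
  sel : Fin p ↪ Fin l
  client : Comb p (fun k => (R (sel k)).clientIn) (fun k => (R (sel k)).clientOut)
    T.clientIn T.clientOut
  source : Comb p (fun k => (R (sel k)).sourceIn) (fun k => (R (sel k)).sourceOut)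
    T.sourceIn T.sourceOut

/-- Applying a protocol to resources. -/
def Protocol.apply {l : ℕ} {R : Fin l → ResType} {T : ResType} (π : Protocol R T)
    (r : ∀ i, (R i).Res) : T.Res :=
  Comb.fill (fun k => r (π.sel k)) π.client π.source

/-- The attack model of a dishonest source: everything but the comb of the source is as in `π`;
the comb of the source, and hence its input `C` and output `D`, are arbitrary. -/
def attacks {l : ℕ} {R : Fin l → ResType} {T : ResType} (π : Protocol R T) (C D : Sys) :
    Set (Protocol R (T.withSource C D)) :=
  {a | ∃ s, a = ⟨π.p, π.sel, π.client, s⟩}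

/-- The trivial comb with one hole. -/
def Comb.idComb (C D : Sys) : Comb 1 (fun _ => C) (fun _ => D) C D :=
  .step Sys.unit (Chan.runitInv C) (.done (Chan.runit D))

/-- The identity protocol on a resource type. -/
def Protocol.id (T : ResType) : Protocol (fun _ : Fin 1 => T) T where
  p := 1
  sel := Function.Embedding.refl _
  client := Comb.idComb T.clientIn T.clientOut
  source := Comb.idComb T.sourceIn T.sourceOut

/-! ### The ideal resource for one client -/

/-- `k` registers, each with the state space `M_n(ℂ)`. -/
abbrev reg (n k : ℕ) : Sys := Sys.mat (Fin k → Fin n)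

/-- One register `M_n(ℂ)`. -/
abbrev qudit (n : ℕ) : Sys := Sys.mat (Fin n)

/-- The type of the ideal resource: the source inputs a bit, and the client receives a state or
the abort signal. -/
abbrev idealType (n : ℕ) : ResType := ⟨Sys.unit, Sys.bit, qudit n ⊕ₛ Sys.unit, Sys.unit⟩

/-- The type of the resource seen when the source is honest: the source has no input. -/
abbrev realType (n : ℕ) : ResType := ⟨Sys.unit, Sys.unit, qudit n ⊕ₛ Sys.unit, Sys.unit⟩

/-- The ideal quantum state verification resource: if the source inputs `c = 0` the client
receives the target state `φ`, otherwise the client receives the abort signal. -/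
def idealQSV {n : ℕ} (φ : State (qudit n)) : (idealType n).Res :=
  (Chan.runitInv (qudit n ⊕ₛ Sys.unit)).comp
    ((Chan.ife (Chan.prep φ) (Chan.id Sys.unit)).comp (Chan.swap Sys.unit Sys.bit))

/-- The filter: it inputs `c = 0` on behalf of the honest source. -/
def filterS (n : ℕ) : Protocol (fun _ : Fin 1 => idealType n) (realType n) where
  p := 1
  sel := Function.Embedding.refl _
  client := Comb.idComb Sys.unit (qudit n ⊕ₛ Sys.unit)
  source := .step Sys.unit ((Chan.runitInv Sys.bit).comp (Chan.prep State.zero))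
    (.done (Chan.runit Sys.unit))

/-! ### The simple protocol -/

/-- The type of a quantum channel from the source to the client. -/
abbrev quantumType (n : ℕ) : ResType := ⟨Sys.unit, qudit n, qudit n, Sys.unit⟩

/-- The noiseless quantum communication channel from the source to the client. -/
def quantumChannel (n : ℕ) : (quantumType n).Res := Chan.swap Sys.unit (qudit n)

theorem posSemidef_pow {n : ℕ} {R : Matrix (Fin n) (Fin n) ℂ} (hR : R.PosSemidef) (k : ℕ) :
    (Matrix.of fun a b : Fin k → Fin n => ∏ i, R (a i) (b i)).PosSemidef := by
  obtain ⟨m, v, hv⟩ := Matrix.posSemidef_iff_eq_sum_vecMulVec.mp hR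
  have h0 : ∀ a b : Fin n, R a b = ∑ j, v j a * star (v j b) := fun a b => by
    rw [hv, Matrix.sum_apply]
    rfl
  have h : (Matrix.of fun a b : Fin k → Fin n => ∏ i, R (a i) (b i)) =
      (Matrix.of fun (s : Fin k → Fin m) (a : Fin k → Fin n) => ∏ i, star (v (s i) (a i)))ᴴ *
        (Matrix.of fun (s : Fin k → Fin m) (a : Fin k → Fin n) => ∏ i, star (v (s i) (a i))) := by
    ext a b
    simp only [h0, Matrix.mul_apply, Matrix.of_apply, Matrix.conjTranspose_apply,
      Finset.prod_univ_sum, Fintype.piFinset_univ, star_prod, Finset.prod_mul_distrib, star_star]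
  rw [h]
  exact Matrix.posSemidef_conjTranspose_mul_self _

/-- The state `ρ^{⊗k}`. -/
def State.pow {n : ℕ} (ρ : State (qudit n)) (k : ℕ) : State (reg n k) where
  op := fun _ => Matrix.of fun a b => ∏ i, ρ.op () (a i) (b i)
  pos := fun _ => posSemidef_pow (ρ.pos ()) k
  tr_eq_one := by
    have h1 : ∑ a : Fin n, ρ.op () a a = 1 := by
      have h := ρ.tr_eq_one
      change ∑ _ : Unit, ∑ a : Fin n, ρ.op () a a = 1 at h
      simpa using h
    change ∑ _ : Unit, ∑ a : Fin k → Fin n, ∏ i, ρ.op () (a i) (a i) = 1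
    have h2 := (Finset.prod_univ_sum (fun _ : Fin k => (Finset.univ : Finset (Fin n)))
      (fun _ a => ρ.op () a a)).symm
    rw [Fintype.piFinset_univ, h1] at h2
    simp [h2]

/-- Moving the register `r` behind all other registers, which keep their order. -/
def moveBack (n : ℕ) {N : ℕ} (r : Fin (N + 1)) : Chan (reg n (N + 1)) (reg n (N + 1)) :=
  Chan.relabel (A := reg n (N + 1)) (B := reg n (N + 1)) (Equiv.refl _) fun _ =>
    (((finSuccEquiv' (Fin.last N)).trans (finSuccEquiv' r).symm).arrowCongr (Equiv.refl _))

/-- Splitting off the first register. -/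
def splitFirst (n k : ℕ) : Chan (reg n (k + 1)) (qudit n ⊗ₛ reg n k) :=
  Chan.relabel (A := reg n (k + 1)) (B := qudit n ⊗ₛ reg n k) (Equiv.prodPUnit Unit)
    fun _ => Fin.consEquiv fun _ => Fin n

/-- Splitting off the last register. -/
def splitLast (n k : ℕ) : Chan (reg n (k + 1)) (reg n k ⊗ₛ qudit n) :=
  Chan.relabel (A := reg n (k + 1)) (B := reg n k ⊗ₛ qudit n) (Equiv.prodPUnit Unit)
    fun _ => (Equiv.prodComm _ _).trans (Fin.snocEquiv fun _ => Fin n)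

/-- Storing a received register behind the registers received before. -/
def store (n k : ℕ) : Chan (qudit n ⊗ₛ reg n k) (reg n (k + 1)) :=
  Chan.relabel (A := qudit n ⊗ₛ reg n k) (B := reg n (k + 1)) (Equiv.prodPUnit Unit).symm
    fun _ => (Fin.snocEquiv fun _ => Fin n).symm

/-- No registers, as the tensor unit. -/
def noReg (n : ℕ) : Chan Sys.unit (reg n 0) :=
  Chan.relabel (A := Sys.unit) (B := reg n 0) (Equiv.refl _) fun _ => Equiv.ofUnique (Fin 0 → Fin n) Unit

/-- A source that starts with `p` registers (output by `g`) and sends them one after the other. -/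
def sendComb (n : ℕ) : (p : ℕ) → {C : Sys} → Chan C (reg n p) →
    Comb p (fun _ => qudit n) (fun _ => Sys.unit) C Sys.unit
  | 0, _, g => .done ((Chan.discard (reg n 0)).comp g)
  | p + 1, _, g => .step (reg n p) ((splitFirst n p).comp g) (sendComb n p (Chan.lunit (reg n p)))

/-- A client that already holds `k` registers (output by `g`), receives `p` further registers one
after the other, and then processes all `q = k + p` of them by `final`. -/
def receiveComb (n : ℕ) {D : Sys} {q : ℕ} (final : Chan (reg n q) D) :
    (p k : ℕ) → k + p = q → {C : Sys} → Chan C (reg n k) →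
    Comb p (fun _ => Sys.unit) (fun _ => qudit n) C D
  | 0, k, h, _, g => .done ((final.comp (Chan.relabel (A := reg n k) (B := reg n q)
      (Equiv.refl _) fun _ => (finCongr h.symm).arrowCongr (Equiv.refl _))).comp g)
  | p + 1, k, h, _, g => .step (reg n k) ((Chan.lunitInv (reg n k)).comp g)
      (receiveComb n final p (k + 1) (by omega) (store n k))

/-- The comb of a source that prepares `N + 1` copies of `ρ` and sends them to the client. -/
def copiesComb {n : ℕ} (N : ℕ) (ρ : State (qudit n)) :
    Comb (N + 1) (fun _ => qudit n) (fun _ => Sys.unit) Sys.unit Sys.unit :=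
  sendComb n (N + 1) (Chan.prep (ρ.pow (N + 1)))

/-- What the client does with the `N + 1` received registers: sample `r` from `η`, move register
`r` to the end and forget `r`, measure the first `N` registers with `μ`, and output the last
register if the result is `0` and the abort signal otherwise. -/
def clientFinal {n N : ℕ} (η : State (Sys.copies (N + 1) Sys.unit))
    (μ : Chan (reg n N) Sys.bit) : Chan (reg n (N + 1)) (qudit n ⊕ₛ Sys.unit) :=
  (Chan.ife (Chan.id (qudit n)) (Chan.discard (qudit n))).comp <|
    (μ.tensorId (qudit n)).comp <|
    (splitLast n N).comp <|
    (Chan.forgetBranch (N + 1) (reg n (N + 1))).comp <|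
    (Chan.elif (moveBack n)).comp <|
    ((Chan.prep η).tensorId (reg n (N + 1))).comp <|
    Chan.lunitInv (reg n (N + 1))

/-- The simple protocol with target state `φ`, sampling distribution `η` and measurement `μ`. -/
def simpleProtocol {n N : ℕ} (φ : State (qudit n)) (η : State (Sys.copies (N + 1) Sys.unit))
    (μ : Chan (reg n N) Sys.bit) :
    Protocol (fun _ : Fin (N + 1) => quantumType n) (realType n) where
  p := N + 1
  sel := Function.Embedding.refl _
  client := receiveComb n (clientFinal η μ) (N + 1) 0 (Nat.zero_add _) (noReg n)
  source := copiesComb N φ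

/-- The i.i.d. attack: the source prepares and sends `N + 1` copies of `ρ`, while the client acts
as in the protocol `π`. -/
def iidAttack {n N : ℕ} (φ : State (qudit n)) (η : State (Sys.copies (N + 1) Sys.unit))
    (μ : Chan (reg n N) Sys.bit) (ρ : State (qudit n)) :
    Protocol (fun _ : Fin (N + 1) => quantumType n)
      ((realType n).withSource Sys.unit Sys.unit) where
  p := N + 1
  sel := Function.Embedding.refl _
  client := (simpleProtocol φ η μ).client
  source := copiesComb N ρ

/-- A pure state is a projection `|v⟩⟨v|` onto a unit vector; all other states are mixed. -/
def State.IsPure {n : ℕ} (φ : State (qudit n)) : Prop :=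
  ∃ v : Fin n → ℂ, star v ⬝ᵥ v = 1 ∧ φ.op () = vecMulVec v (star v)

end QSV

end

noncomputable section

namespace QSV

open Matrix
open scoped ComplexOrder

/-! All resources compared have trivial input, so each channel is determined by one output, and the
diamond distance becomes a trace distance of outputs. Write `a` and `b` for the probabilities that
`μ` accepts `φ^{⊗N}` and `ρ^{⊗N}`. An i.i.d. source is unaffected by the random reordering, so the
honest output is `aφ ⊕ (1-a)` and the attacked one is `bρ ⊕ (1-b)`. A simulator controls only the
probability of the bit `0`, so it yields `qφ ⊕ (1-q)` for some `q ∈ [0,1]`; the filter is the case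
`q = 1`.

The first distance contributes `1 - a`. For the second, test with the reflection `2|h⟩⟨h| - 1` at a
unit vector `h`: whatever `q` is, it contributes at least `b(⟨h|ρ|h⟩ - ⟨h|φ|h⟩)`. This is
`le_half_diamondDist_add`. It remains to find `ρ` and `h` such that `ρ` differs visibly from `φ`
while `μ` accepts its copies almost as readily as those of `φ`.

For the bound of order `1/N`, mix weight `1/(2N)` of a basis state into `φ`: then `ρ^{⊗N} ≥ (1-s)^N
φ^{⊗N}`, so `b ≥ a/2`, while the separation is of order `1/N` (`accept_mix_ge`,
`mixed_attack_bound`). For pure `φ`, rotate the vector by an angle of order `1/√N`: the separation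
is of order `1/√N`, yet the `N`-fold overlap stays bounded below, which controls acceptance
(`accept_vecMulVec_ge`, `pure_attack_bound`). -/

/-! ### Evaluating channels on elementary tensors -/

/-- The elementary tensor `x ⊗ y`. -/
def prodOp {A B : Sys} (x : A.Op) (y : B.Op) : (A ⊗ₛ B).Op :=
  fun p => Matrix.of fun b b' => x p.1 b.1 b'.1 * y p.2 b.2 b'.2

theorem tensorIdMap_prodOp {A B : Sys} (L : A.Op →ₗ[ℂ] B.Op) (C : Sys) (x : A.Op) (y : C.Op) :
    tensorIdMap L C (prodOp x y) = prodOp (L x) y := by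
  funext p
  ext b b'
  have h : (fun i => Matrix.of fun a a' => prodOp x y (i, p.2) (a, b.2) (a', b'.2)) =
      y p.2 b.2 b'.2 • x := by
    funext i
    ext a a'
    exact mul_comm _ _
  change L (fun i => Matrix.of fun a a' => prodOp x y (i, p.2) (a, b.2) (a', b'.2)) p.1 b.1 b'.1 = _
  rw [h, map_smul]
  exact mul_comm _ _

theorem Chan.comp_apply {A B C : Sys} (g : Chan B C) (f : Chan A B) (x : A.Op) :
    (g.comp f).map x = g.map (f.map x) := rfl

theorem Chan.tensorId_prodOp {A B : Sys} (Φ : Chan A B) (C : Sys) (x : A.Op) (y : C.Op) :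
    (Φ.tensorId C).map (prodOp x y) = prodOp (Φ.map x) y :=
  tensorIdMap_prodOp Φ.map C x y

theorem Chan.swap_prodOp {A B : Sys} (x : A.Op) (y : B.Op) :
    (Chan.swap A B).map (prodOp x y) = prodOp y x := by
  funext p
  ext b b'
  exact mul_comm _ _

theorem Chan.tensor_prodOp {A B C D : Sys} (Φ : Chan A B) (Ψ : Chan C D) (x : A.Op) (y : C.Op) :
    (Φ.tensor Ψ).map (prodOp x y) = prodOp (Φ.map x) (Ψ.map y) := by
  simp only [Chan.tensor, Chan.comp_apply, Chan.tensorId_prodOp, Chan.swap_prodOp]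

theorem Chan.midSwap_prodOp {A B C D : Sys} (x : A.Op) (y : B.Op) (z : C.Op) (w : D.Op) :
    (Chan.midSwap A B C D).map (prodOp (prodOp x y) (prodOp z w)) =
      prodOp (prodOp x z) (prodOp y w) := by
  funext p
  ext b b'
  exact mul_mul_mul_comm _ _ _ _

/-- The unit of `I = ℂ`. -/
def unitOne : Sys.unit.Op := fun _ => 1

theorem Chan.lunit_prodOp {A : Sys} (x : A.Op) : (Chan.lunit A).map (prodOp unitOne x) = x := by
  funext p
  ext b b'
  exact one_mul _

theorem Chan.lunitInv_apply {A : Sys} (x : A.Op) : (Chan.lunitInv A).map x = prodOp unitOne x := by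
  funext p
  ext b b'
  exact (one_mul _).symm

theorem Chan.runit_prodOp {A : Sys} (x : A.Op) : (Chan.runit A).map (prodOp x unitOne) = x := by
  simp only [Chan.runit, Chan.comp_apply, Chan.swap_prodOp, Chan.lunit_prodOp]

theorem Chan.runitInv_apply {A : Sys} (x : A.Op) : (Chan.runitInv A).map x = prodOp x unitOne := by
  simp only [Chan.runitInv, Chan.comp_apply, Chan.lunitInv_apply, Chan.swap_prodOp]

theorem Sys.unit_op_eq (x : Sys.unit.Op) : x = Sys.unit.tr x • unitOne := by
  funext i
  ext a b
  change x i a b = (∑ _ : Unit, ∑ _ : Unit, x () () ()) * 1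
  simp

theorem Sys.tr_unitOne : Sys.unit.tr unitOne = 1 := by
  change (∑ _ : Unit, ∑ _ : Unit, (1 : ℂ)) = 1
  simp

/-- Trace preservation leaves only one channel into `I`, so the last step of a source without output
cannot matter. -/
theorem Chan.apply_eq_tr {A : Sys} (Φ : Chan A Sys.unit) (x : A.Op) :
    Φ.map x = A.tr x • unitOne := by
  rw [Sys.unit_op_eq (Φ.map x), Φ.tp]

theorem Chan.prep_unitOne {A : Sys} (ρ : State A) : (Chan.prep ρ).map unitOne = ρ.op := by
  funext i
  exact one_smul ℂ _

theorem prodOp_smul_left {A B : Sys} (c : ℂ) (x : A.Op) (y : B.Op) :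
    prodOp (c • x) y = c • prodOp x y := by
  funext p
  ext b b'
  exact mul_assoc _ _ _

theorem prodOp_smul_right {A B : Sys} (c : ℂ) (x : A.Op) (y : B.Op) :
    prodOp x (c • y) = c • prodOp x y := by
  funext p
  ext b b'
  exact mul_left_comm _ _ _

theorem prodOp_add_left {A B : Sys} (x x' : A.Op) (y : B.Op) :
    prodOp (x + x') y = prodOp x y + prodOp x' y := by
  funext p
  ext b b'
  exact add_mul _ _ _

theorem prodOp_add_right {A B : Sys} (x : A.Op) (y y' : B.Op) :
    prodOp x (y + y') = prodOp x y + prodOp x y' := by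
  funext p
  ext b b'
  exact mul_add _ _ _

theorem prodOp_sub_left {A B : Sys} (x x' : A.Op) (y : B.Op) :
    prodOp (x - x') y = prodOp x y - prodOp x' y := by
  funext p
  ext b b'
  exact sub_mul _ _ _

theorem tr_prodOp {A B : Sys} (x : A.Op) (y : B.Op) :
    (A ⊗ₛ B).tr (prodOp x y) = A.tr x * B.tr y := by
  change ∑ p : A.ι × B.ι, ∑ b : A.β p.1 × B.β p.2, x p.1 b.1 b.1 * y p.2 b.2 b.2 =
    (∑ i, ∑ a, x i a a) * ∑ j, ∑ c, y j c c
  rw [Fintype.sum_prod_type, Finset.sum_mul_sum]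
  refine Finset.sum_congr rfl fun i _ => Finset.sum_congr rfl fun j _ => ?_
  rw [Fintype.sum_prod_type, Finset.sum_mul_sum]

/-! ### Registers -/

theorem splitFirst_pow {n : ℕ} (ρ : State (qudit n)) (k : ℕ) :
    (splitFirst n k).map (ρ.pow (k + 1)).op = prodOp ρ.op (ρ.pow k).op := by
  funext p
  ext b b'
  exact (Fin.prod_univ_succ _).trans rfl

theorem prod_snoc {n k : ℕ} (R : Matrix (Fin n) (Fin n) ℂ) (a a' : Fin k → Fin n) (x x' : Fin n) :
    ∏ i, R (Fin.snoc (α := fun _ => Fin n) a x i) (Fin.snoc (α := fun _ => Fin n) a' x' i) =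
      (∏ i, R (a i) (a' i)) * R x x' := by
  rw [Fin.prod_univ_castSucc]
  simp

theorem splitLast_pow {n : ℕ} (ρ : State (qudit n)) (k : ℕ) :
    (splitLast n k).map (ρ.pow (k + 1)).op = prodOp (ρ.pow k).op ρ.op := by
  funext p
  ext b b'
  exact prod_snoc (ρ.op ()) b.1 b'.1 b.2 b'.2

theorem store_pow {n : ℕ} (ρ : State (qudit n)) (k : ℕ) :
    (store n k).map (prodOp ρ.op (ρ.pow k).op) = (ρ.pow (k + 1)).op := by
  funext p
  ext b b'
  refine Eq.trans ?_ (Fin.prod_univ_castSucc _).symm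
  exact mul_comm _ _

theorem noReg_unitOne {n : ℕ} (ρ : State (qudit n)) : (noReg n).map unitOne = (ρ.pow 0).op := by
  funext p
  ext b b'
  have h : b = b' := Subsingleton.elim _ _
  exact (Finset.prod_empty (ι := Fin 0) (f := fun i => ρ.op () (b i) (b' i))).symm

theorem relabel_cast_pow {n k q : ℕ} (h : k = q) (ρ : State (qudit n)) :
    (Chan.relabel (A := reg n k) (B := reg n q)
      (Equiv.refl _) fun _ => (finCongr h.symm).arrowCongr (Equiv.refl _)).map (ρ.pow k).op =
      (ρ.pow q).op := by
  subst h
  rfl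

theorem moveBack_pow {n N : ℕ} (r : Fin (N + 1)) (ρ : State (qudit n)) :
    (moveBack n r).map (ρ.pow (N + 1)).op = (ρ.pow (N + 1)).op := by
  funext p
  ext b b'
  exact Equiv.prod_comp ((finSuccEquiv' (Fin.last N)).trans (finSuccEquiv' r).symm).symm
    fun i => ρ.op () (b i) (b' i)

theorem forgetBranch_apply {n : ℕ} {A : Sys} (X : (Sys.copies n A).Op) (i : A.ι) (a a' : A.β i) :
    (Chan.forgetBranch n A).map X i a a' = ∑ k, X (k, i) a a' := by
  change (∑ p : Fin n × Unit, ∑ _ : Unit, X (p.1, i) a a') = _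
  rw [Fintype.sum_prod_type]
  simp

theorem elif_prodOp {n : ℕ} {A B : Sys} (Φ : Fin n → Chan A B) (y : (Sys.copies n Sys.unit).Op)
    (x : A.Op) (k : Fin n) (i : B.ι) :
    (Chan.elif Φ).map (prodOp y x) (k, i) = y (k, ()) () () • (Φ k).map x i := by
  have h : (fun i => (Chan.branchUp n A).map (prodOp y x) (k, i)) = y (k, ()) () () • x := rfl
  change (Φ k).map (fun i => (Chan.branchUp n A).map (prodOp y x) (k, i)) i = _
  rw [h, map_smul]
  rfl

/-- Identical copies are permutation invariant, so every branch gives the same state and the weights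
of `η` sum to one: sampling does not help against i.i.d. attacks. -/
theorem sampling_pow {n N : ℕ} (η : State (Sys.copies (N + 1) Sys.unit)) (ρ : State (qudit n)) :
    (Chan.forgetBranch (N + 1) (reg n (N + 1))).map
      ((Chan.elif (moveBack n)).map (prodOp η.op (ρ.pow (N + 1)).op)) = (ρ.pow (N + 1)).op := by
  have h1 : ∑ k : Fin (N + 1), η.op (k, ()) () () = 1 := by
    have := η.tr_eq_one
    change ∑ p : Fin (N + 1) × Unit, ∑ _ : Unit, η.op (p.1, p.2) () () = 1 at this
    rw [Fintype.sum_prod_type] at this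
    simpa using this
  funext i
  ext a a'
  rw [forgetBranch_apply]
  have h : ∀ k : Fin (N + 1), (Chan.elif (moveBack n)).map (prodOp η.op (ρ.pow (N + 1)).op)
      (k, i) a a' = η.op (k, ()) () () * (ρ.pow (N + 1)).op i a a' := by
    intro k
    refine (congrFun (congrFun
      (elif_prodOp (moveBack n) η.op (ρ.pow (N + 1)).op k i) a) a').trans ?_
    rw [moveBack_pow]
    rfl
  refine (Finset.sum_congr rfl fun k _ => h k).trans ?_
  rw [← Finset.sum_mul, h1, one_mul]

/-! ### Outputs of the protocols -/

/-- The element `X ⊕ c` of `M_n(ℂ) ⊕ I`. -/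
def outcome {n : ℕ} (X : Matrix (Fin n) (Fin n) ℂ) (c : ℂ) : (qudit n ⊕ₛ Sys.unit).Op :=
  fun s => match s with
    | Sum.inl _ => X
    | Sum.inr _ => c • (1 : Matrix Unit Unit ℂ)

/-- The `k`-th component of an element of `I ⊕ I`. -/
def bitVal (x : Sys.bit.Op) (k : Bool) : ℂ :=
  match k with
  | false => x (Sum.inl ()) () ()
  | true => x (Sum.inr ()) () ()

theorem tr_bit (x : Sys.bit.Op) : Sys.bit.tr x = bitVal x false + bitVal x true := by
  refine (Fintype.sum_sum_type _).trans ?_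
  change (∑ _ : Unit, ∑ _ : Unit, x (Sum.inl ()) () ()) +
    (∑ _ : Unit, ∑ _ : Unit, x (Sum.inr ()) () ()) = _
  simp [bitVal]

theorem ife_prodOp_inl {A B C : Sys} (Φ : Chan A B) (Ψ : Chan A C) (x : Sys.bit.Op) (y : A.Op)
    (j : B.ι) :
    (Chan.ife Φ Ψ).map (prodOp x y) (Sum.inl j) = bitVal x false • Φ.map y j := by
  have h : (fun i => (Chan.branchUp₂ A).map (prodOp x y) (Sum.inl i)) = bitVal x false • y := rfl
  change Φ.map (fun i => (Chan.branchUp₂ A).map (prodOp x y) (Sum.inl i)) j = _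
  rw [h, map_smul]
  rfl

theorem ife_prodOp_inr {A B C : Sys} (Φ : Chan A B) (Ψ : Chan A C) (x : Sys.bit.Op) (y : A.Op)
    (j : C.ι) :
    (Chan.ife Φ Ψ).map (prodOp x y) (Sum.inr j) = bitVal x true • Ψ.map y j := by
  have h : (fun i => (Chan.branchUp₂ A).map (prodOp x y) (Sum.inr i)) = bitVal x true • y := rfl
  change Ψ.map (fun i => (Chan.branchUp₂ A).map (prodOp x y) (Sum.inr i)) j = _
  rw [h, map_smul]
  rfl

theorem clientFinal_pow {n N : ℕ} (η : State (Sys.copies (N + 1) Sys.unit))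
    (μ : Chan (reg n N) Sys.bit) (ρ : State (qudit n)) :
    (clientFinal η μ).map (ρ.pow (N + 1)).op =
      outcome (bitVal (μ.map (ρ.pow N).op) false • ρ.op ()) (bitVal (μ.map (ρ.pow N).op) true) := by
  simp only [clientFinal, Chan.comp_apply, Chan.lunitInv_apply, Chan.tensorId_prodOp,
    Chan.prep_unitOne, sampling_pow, splitLast_pow]
  funext s
  rcases s with j | j
  · rw [ife_prodOp_inl]
    rfl
  · rw [ife_prodOp_inr, Chan.apply_eq_tr, ρ.tr_eq_one, one_smul]
    rfl

/-- Induction on the remaining rounds `p`, with the invariant that the client holds `ρ^{⊗k}` and the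
source `ρ^{⊗p}`. The channels `g₁`, `g₂` and their inputs are general because each round replaces
them by `store` and a unitor. -/
theorem fill_receiveComb_sendComb {n q : ℕ} {D : Sys} (final : Chan (reg n q) D)
    (ρ : State (qudit n)) : ∀ (p k : ℕ) (h : k + p = q) {C₁ C₂ : Sys} (g₁ : Chan C₁ (reg n k))
    (g₂ : Chan C₂ (reg n p)) (x : C₁.Op) (y : C₂.Op), g₁.map x = (ρ.pow k).op →
    g₂.map y = (ρ.pow p).op →
    (Comb.fill (fun _ => quantumChannel n) (receiveComb n final p k h g₁)
      (sendComb n p g₂)).map (prodOp x y) = prodOp (final.map (ρ.pow q).op) unitOne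
  | 0, k, h, _, _, g₁, g₂, x, y, h₁, h₂ => by
    change (Chan.tensor _ _).map _ = _
    rw [Chan.tensor_prodOp, Chan.comp_apply, Chan.comp_apply, Chan.comp_apply, h₁, h₂,
      Chan.apply_eq_tr, (ρ.pow 0).tr_eq_one, one_smul]
    exact congrArg (fun z => prodOp (final.map z) unitOne) (relabel_cast_pow h ρ)
  | p + 1, k, h, _, _, g₁, g₂, x, y, h₁, h₂ => by
    change (Comb.fill (fun _ => quantumChannel n) (receiveComb n final p (k + 1) _ (store n k))
      (sendComb n p (Chan.lunit (reg n p)))).map ((Chan.midSwap _ _ _ _).map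
        (((quantumChannel n).tensorId _).map ((Chan.midSwap _ _ _ _).map
          ((Chan.tensor _ _).map (prodOp x y))))) = _
    rw [Chan.tensor_prodOp, Chan.comp_apply, Chan.comp_apply, h₁, h₂, Chan.lunitInv_apply,
      splitFirst_pow, Chan.midSwap_prodOp, Chan.tensorId_prodOp, quantumChannel,
      Chan.swap_prodOp, Chan.midSwap_prodOp]
    exact fill_receiveComb_sendComb final ρ p (k + 1) _ _ _ _ _ (store_pow ρ k)
      (Chan.lunit_prodOp _)

theorem iidAttack_apply {n N : ℕ} (φ : State (qudit n)) (η : State (Sys.copies (N + 1) Sys.unit))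
    (μ : Chan (reg n N) Sys.bit) (ρ : State (qudit n)) :
    ((iidAttack φ η μ ρ).apply fun _ => quantumChannel n).map (prodOp unitOne unitOne) =
      prodOp (outcome (bitVal (μ.map (ρ.pow N).op) false • ρ.op ())
        (bitVal (μ.map (ρ.pow N).op) true)) unitOne := by
  rw [← clientFinal_pow η]
  exact fill_receiveComb_sendComb (clientFinal η μ) ρ (N + 1) 0 (Nat.zero_add _) _ _ _ _ (noReg_unitOne ρ)
    (Chan.prep_unitOne _)

/-! ### A simulator's comb filled with the ideal resource -/

/-- The element `c ⊕ d` of `I ⊕ I`. -/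
def bitOp (c d : ℂ) : Sys.bit.Op :=
  fun s => match s with
    | Sum.inl _ => c • (1 : Matrix Unit Unit ℂ)
    | Sum.inr _ => d • (1 : Matrix Unit Unit ℂ)

/-- The component of an element of `(I ⊕ I) ⊗ Z` for the value `k` of the bit. -/
def bitSlice {Z : Sys} (X : (Sys.bit ⊗ₛ Z).Op) (k : Bool) : Z.Op :=
  match k with
  | false => fun j => Matrix.of fun c c' => X (Sum.inl (), j) ((), c) ((), c')
  | true => fun j => Matrix.of fun c c' => X (Sum.inr (), j) ((), c) ((), c')

/-- Since the bit is classical, two elementary tensors suffice; this is what lets linearity handle a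
bit correlated with the memory. -/
theorem eq_bitSlice {Z : Sys} (X : (Sys.bit ⊗ₛ Z).Op) :
    X = prodOp (bitOp 1 0) (bitSlice X false) + prodOp (bitOp 0 1) (bitSlice X true) := by
  funext p
  obtain ⟨s, j⟩ := p
  rcases s with s | s <;> ext b b'
  · change _ = ((1 : ℂ) * 1) * _ + (0 * 1 : ℂ) * _
    simp only [one_mul, zero_mul, add_zero]
    rfl
  · change _ = ((0 : ℂ) * 1) * _ + (1 * 1 : ℂ) * _
    simp only [one_mul, zero_mul, zero_add]
    rfl

theorem idealQSV_apply {n : ℕ} (φ : State (qudit n)) (c d : ℂ) :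
    (idealQSV φ).map (prodOp unitOne (bitOp c d)) =
      prodOp (outcome (c • φ.op ()) d) unitOne := by
  simp only [idealQSV, Chan.comp_apply, Chan.swap_prodOp, Chan.runitInv_apply]
  congr 1
  funext s
  rcases s with j | j
  · rw [ife_prodOp_inl, Chan.prep_unitOne]
    change (c * 1) • _ = _
    rw [mul_one]
    rfl
  · rw [ife_prodOp_inr]
    change (d * 1) • _ = _
    rw [mul_one]
    rfl

theorem outcome_combine {n : ℕ} (X : Matrix (Fin n) (Fin n) ℂ) (c d : ℂ) :
    c • outcome ((1 : ℂ) • X) 0 + d • outcome ((0 : ℂ) • X) 1 = outcome (c • X) d := by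
  funext s
  rcases s with j | j
  · change c • ((1 : ℂ) • X) + d • ((0 : ℂ) • X) = c • X
    simp
  · change c • ((0 : ℂ) • (1 : Matrix Unit Unit ℂ)) + d • ((1 : ℂ) • (1 : Matrix Unit Unit ℂ)) =
      d • (1 : Matrix Unit Unit ℂ)
    simp

/-- The memory `Z` ends up discarded, so only the marginal of the bit survives. -/
theorem fill_idComb_idealQSV {n : ℕ} (φ : State (qudit n)) {Z : Sys}
    (h : Chan Sys.unit (Sys.bit ⊗ₛ Z)) (k : Chan (Sys.unit ⊗ₛ Z) Sys.unit) :
    (Comb.fill (fun _ => idealQSV φ) (Comb.idComb Sys.unit (qudit n ⊕ₛ Sys.unit))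
      (Comb.step (A := fun _ => Sys.bit) (B := fun _ => Sys.unit) Z h (Comb.done k))).map
        (prodOp unitOne unitOne) =
      prodOp (outcome (Z.tr (bitSlice (h.map unitOne) false) • φ.op ())
        (Z.tr (bitSlice (h.map unitOne) true))) unitOne := by
  change ((Chan.runit _).tensor k).map ((Chan.midSwap _ _ _ _).map
    (((idealQSV φ).tensorId _).map ((Chan.midSwap _ _ _ _).map
      ((Chan.tensor _ _).map (prodOp unitOne unitOne))))) = _
  have key : ∀ (c d : ℂ) (z : Z.Op), ((Chan.runit _).tensor k).map ((Chan.midSwap _ _ _ _).map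
      (((idealQSV φ).tensorId _).map ((Chan.midSwap _ _ _ _).map
        (prodOp (prodOp unitOne unitOne) (prodOp (bitOp c d) z))))) =
      prodOp (Z.tr z • outcome (c • φ.op ()) d) unitOne := by
    intro c d z
    rw [Chan.midSwap_prodOp, Chan.tensorId_prodOp, idealQSV_apply, Chan.midSwap_prodOp,
      Chan.tensor_prodOp, Chan.runit_prodOp, Chan.apply_eq_tr, tr_prodOp, Sys.tr_unitOne, one_mul,
      prodOp_smul_right, prodOp_smul_left]
  rw [Chan.tensor_prodOp, Chan.runitInv_apply, eq_bitSlice (h.map unitOne), prodOp_add_right,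
    map_add, map_add, map_add, map_add, key, key, ← eq_bitSlice, ← prodOp_add_left,
    outcome_combine]

/-! ### Lower bounds on the trace norm and the diamond distance -/

-- With `V` diagonalising `X Xᴴ`, write `tr (U X) = tr ((Vᴴ X)(U V))`. Row `i` of `Vᴴ X` has norm
-- `√λᵢ` and the columns of `U V` are unit vectors, so Cauchy–Schwarz in each row gives the bound.
open Classical in
theorem re_trace_mul_le_matTraceNorm {d : Type} [Fintype d] (U X : Matrix d d ℂ)
    (hU : Uᴴ * U = 1) : (U * X).trace.re ≤ matTraceNorm X := by
  have hH := isHermitian_mul_conjTranspose_self X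
  set V : Matrix d d ℂ := hH.eigenvectorUnitary.1 with hV
  have hV1 : Vᴴ * V = 1 := Unitary.coe_star_mul_self hH.eigenvectorUnitary
  have hV2 : V * Vᴴ = 1 := Unitary.coe_mul_star_self hH.eigenvectorUnitary
  have hd : Vᴴ * (X * Xᴴ) * V = diagonal (Complex.ofReal ∘ hH.eigenvalues) := by
    have h : star (hH.eigenvectorUnitary : Matrix d d ℂ) * (X * Xᴴ) * hH.eigenvectorUnitary =
        diagonal (Complex.ofReal ∘ hH.eigenvalues) := by
      simpa [Unitary.conjStarAlgAut_apply] using hH.conjStarAlgAut_star_eigenvectorUnitary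
    exact h
  have hrow : ∀ i, ∑ j, ‖(Vᴴ * X) i j‖ ^ 2 = hH.eigenvalues i := by
    intro i
    have h : ((Vᴴ * X) * (Vᴴ * X)ᴴ) i i = (hH.eigenvalues i : ℂ) := by
      rw [conjTranspose_mul, conjTranspose_conjTranspose, Matrix.mul_assoc, ← Matrix.mul_assoc X,
        ← Matrix.mul_assoc, hd, diagonal_apply_eq]
      rfl
    rw [Matrix.mul_apply] at h
    simp only [conjTranspose_apply, RCLike.star_def, Complex.mul_conj'] at h
    exact_mod_cast h
  have hcol : ∀ i, ∑ j, ‖(U * V) j i‖ ^ 2 = 1 := by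
    intro i
    have h : ((U * V)ᴴ * (U * V)) i i = 1 := by
      rw [conjTranspose_mul, Matrix.mul_assoc, ← Matrix.mul_assoc Uᴴ, hU, Matrix.one_mul, hV1,
        one_apply_eq]
    rw [Matrix.mul_apply] at h
    simp only [conjTranspose_apply, RCLike.star_def, Complex.conj_mul'] at h
    exact_mod_cast h
  have ht : (U * X).trace = ∑ i, ∑ j, (Vᴴ * X) i j * (U * V) j i := by
    have : U * X = (U * V) * (Vᴴ * X) := by
      rw [Matrix.mul_assoc, ← Matrix.mul_assoc V, hV2, Matrix.one_mul]
    rw [this, Matrix.trace_mul_comm]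
    rfl
  rw [ht, Complex.re_sum]
  refine Finset.sum_le_sum fun i _ => ?_
  calc (∑ j, (Vᴴ * X) i j * (U * V) j i).re ≤ ‖∑ j, (Vᴴ * X) i j * (U * V) j i‖ :=
        Complex.re_le_norm _
    _ ≤ ∑ j, ‖(Vᴴ * X) i j‖ * ‖(U * V) j i‖ :=
        (norm_sum_le _ _).trans_eq (Finset.sum_congr rfl fun j _ => norm_mul _ _)
    _ ≤ √(∑ j, ‖(Vᴴ * X) i j‖ ^ 2) * √(∑ j, ‖(U * V) j i‖ ^ 2) :=
        Real.sum_mul_le_sqrt_mul_sqrt _ _ _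
    _ = √(hH.eigenvalues i) := by rw [hrow, hcol, Real.sqrt_one, mul_one]

/-- Absorbs the `Unit` factors that tensoring with trivial systems adds to the index sets. -/
theorem re_trace_mul_le_matTraceNorm_submatrix {d e : Type} [Fintype d] [DecidableEq d] [Fintype e]
    (f : e ≃ d) (U X : Matrix d d ℂ) (hU : Uᴴ * U = 1) :
    (U * X).trace.re ≤ matTraceNorm (X.submatrix f f) := by
  classical
  have h := re_trace_mul_le_matTraceNorm (U.submatrix f f) (X.submatrix f f) (by
    rw [conjTranspose_submatrix, submatrix_mul_equiv, hU, submatrix_one_equiv])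
  rw [submatrix_mul_equiv] at h
  refine le_trans (le_of_eq ?_) h
  exact congrArg Complex.re (Equiv.sum_comp f fun a => (U * X) a a).symm

/-- The algebra `I ⊗ I` of the joint input of two parties without input. -/
abbrev Sys.unit₂ : Sys := Sys.unit ⊗ₛ Sys.unit

/-- The only state of `(I ⊗ I) ⊗ (I ⊗ I)`. -/
def unitState : State (Sys.unit₂ ⊗ₛ Sys.unit₂) where
  op := prodOp (prodOp unitOne unitOne) (prodOp unitOne unitOne)
  pos := fun p => by
    classical
    refine (congrArg Matrix.PosSemidef (Matrix.ext fun a b => ?_)).mp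
      (Matrix.PosSemidef.one (n := (Unit × Unit) × (Unit × Unit)) (R := ℂ))
    change (if a = b then (1 : ℂ) else 0) = (1 * 1) * (1 * 1)
    rw [if_pos (Subsingleton.elim a b)]
    norm_num
  tr_eq_one := by simp only [tr_prodOp, Sys.tr_unitOne, mul_one]

theorem state_unit₂_eq (ρ : State (Sys.unit₂ ⊗ₛ Sys.unit₂)) : ρ.op = unitState.op := by
  funext p
  ext a b
  have h : ∑ _ : (Unit × Unit) × (Unit × Unit), ∑ _ : (Unit × Unit) × (Unit × Unit),
    ρ.op (((), ()), ((), ())) (((), ()), ((), ())) (((), ()), ((), ())) = 1 := ρ.tr_eq_one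
  rw [Finset.sum_const, Finset.sum_const, Finset.card_univ, Fintype.card_eq_one_iff.mpr
    ⟨(((), ()), ((), ())), fun _ => rfl⟩, one_smul, one_smul] at h
  refine Eq.trans h ?_
  change (1 : ℂ) = (1 * 1) * (1 * 1)
  norm_num

theorem traceNorm_outcome_type {n : ℕ}
    (Z : (((qudit n ⊕ₛ Sys.unit) ⊗ₛ Sys.unit) ⊗ₛ Sys.unit₂).Op) :
    Sys.traceNorm _ Z =
      matTraceNorm (d := (Fin n × Unit) × (Unit × Unit)) (Z ((Sum.inl (), ()), ((), ()))) +
      matTraceNorm (d := (Unit × Unit) × (Unit × Unit)) (Z ((Sum.inr (), ()), ((), ()))) := by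
  refine (Fintype.sum_prod_type _).trans ((Fintype.sum_prod_type _).trans
    ((Fintype.sum_sum_type _).trans ?_))
  have h₁ : ∀ f : Unit → ℝ, ∑ i, f i = f () := fun f => Fintype.sum_unique f
  have h₂ : ∀ f : Unit × Unit → ℝ, ∑ i, f i = f ((), ()) := fun f => by
    rw [Fintype.sum_prod_type, h₁, h₁]
  exact congrArg₂ (· + ·) ((h₁ _).trans ((h₁ _).trans (h₂ _)))
    ((h₁ _).trans ((h₁ _).trans (h₂ _)))

/-- The trace norm adds over blocks, so each block may be tested separately: the quantum block by an
isometry `U`, the abort block by a sign `s`. -/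
theorem le_diamondDist {n : ℕ} (Φ Ψ : Chan Sys.unit₂ ((qudit n ⊕ₛ Sys.unit) ⊗ₛ Sys.unit))
    (X Y U : Matrix (Fin n) (Fin n) ℂ) (x y s : ℝ) (hU : Uᴴ * U = 1) (hs : s * s = 1)
    (hΦ : Φ.map (prodOp unitOne unitOne) = prodOp (outcome X x) unitOne)
    (hΨ : Ψ.map (prodOp unitOne unitOne) = prodOp (outcome Y y) unitOne) :
    (U * (X - Y)).trace.re + s * (x - y) ≤ diamondDist Φ Ψ := by
  have hL : tensorIdMap (Φ.map - Ψ.map) Sys.unit₂ unitState.op =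
      prodOp (prodOp (outcome (X - Y) (x - y)) unitOne) (prodOp unitOne unitOne) := by
    refine (tensorIdMap_prodOp _ _ _ _).trans ?_
    rw [LinearMap.sub_apply, hΦ, hΨ, ← prodOp_sub_left]
    congr 2
    funext j
    rcases j with j | j
    · rfl
    · exact (sub_smul _ _ _).symm
  have hle : Sys.traceNorm _ (tensorIdMap (Φ.map - Ψ.map) Sys.unit₂ unitState.op) ≤
      diamondDist Φ Ψ := by
    -- A real `sSup` needs a bounded set; here the set is a singleton, since `unitState` is the only
    -- input state.
    refine le_csSup ⟨Sys.traceNorm _ (tensorIdMap (Φ.map - Ψ.map) Sys.unit₂ unitState.op), ?_⟩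
      ⟨unitState, rfl⟩
    rintro _ ⟨ρ, rfl⟩
    exact le_of_eq (congrArg (fun z => Sys.traceNorm _ (tensorIdMap (Φ.map - Ψ.map) Sys.unit₂ z))
      (state_unit₂_eq ρ))
  refine le_trans ?_ hle
  rw [hL]
  rw [traceNorm_outcome_type]
  refine add_le_add ?_ ?_
  · refine (re_trace_mul_le_matTraceNorm_submatrix
      (e := (Fin n × Unit) × (Unit × Unit))
      ⟨fun b => b.1.1, fun a => ((a, ()), ((), ())), fun _ => rfl, fun _ => rfl⟩
      U (X - Y) hU).trans_eq (congrArg matTraceNorm ?_)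
    ext a b
    change (X - Y) a.1.1 b.1.1 = ((X - Y) a.1.1 b.1.1 * 1) * (1 * 1)
    rw [mul_one, mul_one, mul_one]
  · have h := re_trace_mul_le_matTraceNorm_submatrix
      (e := (Unit × Unit) × (Unit × Unit))
      ⟨fun b => b.1.1, fun a => ((a, ()), ((), ())), fun _ => rfl, fun _ => rfl⟩
      ((s : ℂ) • (1 : Matrix Unit Unit ℂ)) (((x : ℂ) - y) • (1 : Matrix Unit Unit ℂ)) (by
        rw [conjTranspose_smul, conjTranspose_one, smul_mul_smul_comm, mul_one]
        have : star (s : ℂ) * (s : ℂ) = 1 := by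
          rw [RCLike.star_def, Complex.conj_ofReal]
          exact_mod_cast hs
        rw [this, one_smul])
    refine le_trans (le_of_eq ?_) (h.trans_eq (congrArg matTraceNorm ?_))
    · rw [smul_mul_smul_comm, mul_one, trace_smul, trace_one, Fintype.card_unit, Nat.cast_one,
        smul_eq_mul, mul_one, ← Complex.ofReal_sub, ← Complex.ofReal_mul, Complex.ofReal_re]
    · ext a b
      change ((x : ℂ) - y) * 1 = ((((x : ℂ) - y) * 1) * 1) * (1 * 1)
      ring

/-! ### Acceptance probabilities -/

/-- Complete positivity with a one-dimensional ancilla. -/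
theorem Chan.map_pos {A B : Sys} (Φ : Chan A B) {X : A.Op} (hX : A.Pos X) : B.Pos (Φ.map X) := by
  have h := Φ.cp Unit (prodOp X unitOne) fun p => by
    refine (congrArg Matrix.PosSemidef (Matrix.ext fun a b => ?_)).mp
      ((hX p.1).submatrix fun a : A.β p.1 × Unit => a.1)
    exact (mul_one _).symm
  rw [tensorIdMap_prodOp] at h
  intro j
  refine (congrArg Matrix.PosSemidef (Matrix.ext fun a b => ?_)).mp
    ((h (j, ())).submatrix fun b : B.β j => (b, ()))
  exact mul_one _

theorem bitVal_nonneg {x : Sys.bit.Op} (hx : Sys.bit.Pos x) (k : Bool) : 0 ≤ bitVal x k := by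
  cases k
  · exact (hx (Sum.inl ())).diag_nonneg (i := ())
  · exact (hx (Sum.inr ())).diag_nonneg (i := ())

theorem exists_real_of_add_eq_one {a b : ℂ} (ha : 0 ≤ a) (hb : 0 ≤ b) (h : a + b = 1) :
    a = (a.re : ℂ) ∧ b = ((1 - a.re : ℝ) : ℂ) ∧ 0 ≤ a.re ∧ a.re ≤ 1 := by
  have ha' : a = (a.re : ℂ) := Complex.eq_re_of_ofReal_le ha
  have hb' : b = (b.re : ℂ) := Complex.eq_re_of_ofReal_le hb
  have h' : a.re + b.re = 1 := by rw [← Complex.add_re, h, Complex.one_re]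
  have h1 : 0 ≤ a.re := (Complex.nonneg_iff.mp ha).1
  have h2 : 0 ≤ b.re := (Complex.nonneg_iff.mp hb).1
  have h3 : b.re = 1 - a.re := by linarith
  exact ⟨ha', h3 ▸ hb', h1, by linarith⟩

/-- The value of the effect of the result `0` of the measurement `μ`. -/
def accept {n N : ℕ} (μ : Chan (reg n N) Sys.bit)
    (X : Matrix (Fin N → Fin n) (Fin N → Fin n) ℂ) : ℝ :=
  (bitVal (μ.map fun _ => X) false).re

theorem accept_add {n N : ℕ} (μ : Chan (reg n N) Sys.bit)
    (X Y : Matrix (Fin N → Fin n) (Fin N → Fin n) ℂ) :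
    accept μ (X + Y) = accept μ X + accept μ Y := by
  have h : μ.map (fun _ => X + Y) = μ.map (fun _ => X) + μ.map (fun _ => Y) :=
    μ.map.map_add (fun _ => X) (fun _ => Y)
  unfold accept
  rw [h]
  rfl

theorem accept_smul {n N : ℕ} (μ : Chan (reg n N) Sys.bit) (c : ℝ)
    (X : Matrix (Fin N → Fin n) (Fin N → Fin n) ℂ) :
    accept μ ((c : ℂ) • X) = c * accept μ X := by
  have h : μ.map (fun _ => (c : ℂ) • X) = (c : ℂ) • μ.map (fun _ => X) :=
    μ.map.map_smul (c : ℂ) (fun _ => X)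
  unfold accept
  rw [h]
  exact Complex.re_ofReal_mul _ _

theorem accept_nonneg {n N : ℕ} (μ : Chan (reg n N) Sys.bit)
    {X : Matrix (Fin N → Fin n) (Fin N → Fin n) ℂ} (hX : X.PosSemidef) : 0 ≤ accept μ X :=
  (Complex.nonneg_iff.mp (bitVal_nonneg (μ.map_pos (X := fun _ => X) fun _ => hX) false)).1

/-- The two outcomes sum to the trace, and the rejecting one is nonnegative. -/
theorem accept_le_trace {n N : ℕ} (μ : Chan (reg n N) Sys.bit)
    {X : Matrix (Fin N → Fin n) (Fin N → Fin n) ℂ} (hX : X.PosSemidef) :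
    accept μ X ≤ X.trace.re := by
  have h := μ.tp fun _ => X
  rw [tr_bit] at h
  have h1 : (reg n N).tr (fun _ => X) = X.trace := Fintype.sum_unique fun _ : Unit => X.trace
  have h2 := (Complex.nonneg_iff.mp
    (bitVal_nonneg (μ.map_pos (X := fun _ => X) fun _ => hX) true)).1
  rw [← h1, ← h, Complex.add_re]
  exact le_add_of_nonneg_right h2

theorem bitVal_pow {n N : ℕ} (μ : Chan (reg n N) Sys.bit) (ρ : State (qudit n)) :
    bitVal (μ.map (ρ.pow N).op) false = (accept μ ((ρ.pow N).op ()) : ℂ) ∧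
      bitVal (μ.map (ρ.pow N).op) true = ((1 - accept μ ((ρ.pow N).op ()) : ℝ) : ℂ) ∧
      0 ≤ accept μ ((ρ.pow N).op ()) ∧ accept μ ((ρ.pow N).op ()) ≤ 1 := by
  have hp := μ.map_pos (ρ.pow N).pos
  exact exists_real_of_add_eq_one (bitVal_nonneg hp false) (bitVal_nonneg hp true)
    (by rw [← tr_bit, μ.tp, (ρ.pow N).tr_eq_one])

/-! ### Outputs on the ideal resource -/

theorem bitSlice_pos {Z : Sys} {X : (Sys.bit ⊗ₛ Z).Op} (hX : (Sys.bit ⊗ₛ Z).Pos X) (k : Bool) :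
    Z.Pos (bitSlice X k) := by
  intro j
  cases k
  · exact (hX (Sum.inl (), j)).submatrix fun c : Z.β j => ((), c)
  · exact (hX (Sum.inr (), j)).submatrix fun c : Z.β j => ((), c)

theorem Sys.tr_nonneg {A : Sys} {X : A.Op} (hX : A.Pos X) : 0 ≤ A.tr X :=
  Finset.sum_nonneg fun i _ => (hX i).trace_nonneg

theorem tr_bitSlice_add {Z : Sys} (X : (Sys.bit ⊗ₛ Z).Op) :
    Z.tr (bitSlice X false) + Z.tr (bitSlice X true) = (Sys.bit ⊗ₛ Z).tr X := by
  have hadd : ∀ (A : Sys) (x y : A.Op), A.tr (x + y) = A.tr x + A.tr y := fun A x y => by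
    simp [Sys.tr, Finset.sum_add_distrib]
  conv_rhs => rw [eq_bitSlice X, hadd, tr_prodOp, tr_prodOp, tr_bit, tr_bit]
  simp [bitVal, bitOp]

theorem unitOne_pos : Sys.unit.Pos unitOne := fun _ => by
  classical
  refine (congrArg Matrix.PosSemidef (Matrix.ext fun a b => ?_)).mp
    (Matrix.PosSemidef.one (n := Unit) (R := ℂ))
  rfl

/-- A simulator can choose only `q`, the probability of sending the bit `0`. -/
theorem idealAttack_apply {n : ℕ} (φ : State (qudit n))
    (B : Protocol (fun _ : Fin 1 => idealType n) ((idealType n).withSource Sys.unit Sys.unit))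
    (hB : B ∈ attacks (Protocol.id (idealType n)) Sys.unit Sys.unit) :
    ∃ q : ℝ, 0 ≤ q ∧ q ≤ 1 ∧
      (B.apply fun _ => idealQSV φ).map (prodOp unitOne unitOne) =
        prodOp (outcome ((q : ℂ) • φ.op ()) ((1 - q : ℝ) : ℂ)) unitOne := by
  obtain ⟨s, rfl⟩ := hB
  cases s with
  | step Z h rest =>
    cases rest with
    | done k =>
      have hp : (Sys.bit ⊗ₛ Z).Pos (h.map unitOne) := h.map_pos unitOne_pos
      obtain ⟨h1, h2, h3, h4⟩ := exists_real_of_add_eq_one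
        (Sys.tr_nonneg (bitSlice_pos hp false)) (Sys.tr_nonneg (bitSlice_pos hp true))
        (by rw [tr_bitSlice_add]; exact (h.tp unitOne).trans Sys.tr_unitOne)
      refine ⟨_, h3, h4, ?_⟩
      rw [← h1, ← h2]
      exact fill_idComb_idealQSV φ h k

theorem filterS_apply {n : ℕ} (φ : State (qudit n)) :
    ((filterS n).apply fun _ => idealQSV φ).map (prodOp unitOne unitOne) =
      prodOp (outcome (((1 : ℝ) : ℂ) • φ.op ()) ((1 - 1 : ℝ) : ℂ)) unitOne := by
  refine (fill_idComb_idealQSV φ ((Chan.runitInv Sys.bit).comp (Chan.prep State.zero))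
    (Chan.runit Sys.unit)).trans ?_
  rw [Chan.comp_apply, Chan.prep_unitOne, Chan.runitInv_apply]
  have h0 : bitSlice (prodOp State.zero.op unitOne) false = unitOne := by
    funext i
    ext a b
    exact one_mul _
  have h1 : bitSlice (prodOp State.zero.op unitOne) true = (0 : ℂ) • unitOne := by
    funext i
    ext a b
    rfl
  have h2 : Sys.unit.tr ((0 : ℂ) • unitOne) = 0 := by simp [Sys.tr]
  rw [h0, h1, h2, Sys.tr_unitOne]
  norm_num

/-! ### Reduction to acceptance probabilities -/

theorem trace_vecMulVec_star_mul {n : ℕ} (h : Fin n → ℂ) (X : Matrix (Fin n) (Fin n) ℂ) :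
    (vecMulVec h (star h) * X).trace = star h ⬝ᵥ X *ᵥ h := by
  rw [vecMulVec_mul, trace_vecMulVec, dotProduct_comm, dotProduct_mulVec]

theorem State.trace_eq_one {n : ℕ} (ρ : State (qudit n)) : (ρ.op ()).trace = 1 :=
  (Fintype.sum_unique fun _ : Unit => (ρ.op ()).trace).symm.trans ρ.tr_eq_one

/-- For the projection `P = |h⟩⟨h|`, the matrix `2P - 1` is a Hermitian involution. -/
theorem reflection_isometry {n : ℕ} {h : Fin n → ℂ} (hh : star h ⬝ᵥ h = 1) :
    ((2 : ℂ) • vecMulVec h (star h) - 1)ᴴ * ((2 : ℂ) • vecMulVec h (star h) - 1) = 1 := by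
  have hP : vecMulVec h (star h) * vecMulVec h (star h) = vecMulVec h (star h) := by
    rw [vecMulVec_mul_vecMulVec, hh, one_smul]
  have hS : (vecMulVec h (star h))ᴴ = vecMulVec h (star h) := by
    rw [conjTranspose_vecMulVec, star_star]
  rw [conjTranspose_sub, conjTranspose_smul, hS, conjTranspose_one, Matrix.sub_mul,
    Matrix.mul_sub, smul_mul_smul_comm, hP]
  simp only [Matrix.mul_one, Matrix.one_mul, star_ofNat, mul_smul]
  module

/-- Removes the simulator: a suitable sign on the abort block makes the bound independent of `q`,
leaving a problem about `μ`, `ρ` and `h` only. -/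
theorem le_half_diamondDist_add {n N : ℕ} (φ : State (qudit n))
    (η : State (Sys.copies (N + 1) Sys.unit)) (μ : Chan (reg n N) Sys.bit) (ρ : State (qudit n))
    {h : Fin n → ℂ} (hh : star h ⬝ᵥ h = 1)
    (hm : (star h ⬝ᵥ φ.op () *ᵥ h).re ≤ 1)
    (B : Protocol (fun _ : Fin 1 => idealType n) ((idealType n).withSource Sys.unit Sys.unit))
    (hB : B ∈ attacks (Protocol.id (idealType n)) Sys.unit Sys.unit) :
    1 - accept μ ((φ.pow N).op ()) + accept μ ((ρ.pow N).op ()) *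
        ((star h ⬝ᵥ ρ.op () *ᵥ h).re - (star h ⬝ᵥ φ.op () *ᵥ h).re) ≤
      1 / 2 * diamondDist ((simpleProtocol φ η μ).apply fun _ => quantumChannel n)
          ((filterS n).apply fun _ => idealQSV φ) +
        1 / 2 * diamondDist ((iidAttack φ η μ ρ).apply fun _ => quantumChannel n)
          (B.apply fun _ => idealQSV φ) := by
  -- The honest protocol is definitionally the i.i.d. attack with `ρ = φ`.
  have hreal := iidAttack_apply φ η μ φ
  have hatt := iidAttack_apply φ η μ ρ
  obtain ⟨a1, a2, a3, a4⟩ := bitVal_pow μ φ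
  obtain ⟨b1, b2, b3, b4⟩ := bitVal_pow μ ρ
  rw [a1, a2] at hreal
  rw [b1, b2] at hatt
  set a := accept μ ((φ.pow N).op ())
  set b := accept μ ((ρ.pow N).op ())
  obtain ⟨q, q0, q1, hq⟩ := idealAttack_apply φ B hB
  -- The quantum block is `(a - 1)φ`, so `U = -1` is optimal; each block contributes `1 - a`.
  have d1 := le_diamondDist _ _ _ _ (-1) _ _ 1 (by simp) (by norm_num) hreal (filterS_apply φ)
  have e1 : ((-1 : Matrix (Fin n) (Fin n) ℂ) *
      ((a : ℂ) • φ.op () - ((1 : ℝ) : ℂ) • φ.op ())).trace.re = 1 - a := by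
    rw [neg_mul, Matrix.one_mul, trace_neg, trace_sub, trace_smul, trace_smul, φ.trace_eq_one]
    simp
  rw [e1] at d1
  have e2 : (((2 : ℂ) • vecMulVec h (star h) - 1) *
      ((b : ℂ) • ρ.op () - (q : ℂ) • φ.op ())).trace.re =
      2 * (b * (star h ⬝ᵥ ρ.op () *ᵥ h).re - q * (star h ⬝ᵥ φ.op () *ᵥ h).re) - (b - q) := by
    rw [Matrix.sub_mul, Matrix.one_mul, trace_sub, Matrix.smul_mul, trace_smul,
      trace_vecMulVec_star_mul, trace_sub, trace_smul, trace_smul, ρ.trace_eq_one, φ.trace_eq_one,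
      sub_mulVec, dotProduct_sub, smul_mulVec, smul_mulVec, dotProduct_smul, dotProduct_smul]
    simp
  have d2 : ∀ s : ℝ, s * s = 1 → _ := fun s hs =>
    le_diamondDist _ _ _ _ _ _ _ s (reflection_isometry hh) hs hatt hq
  rw [e2] at d2
  have d1' : 1 - a + 1 * (1 - a - (1 - 1)) ≤ diamondDist
    ((simpleProtocol φ η μ).apply fun _ => quantumChannel n)
          ((filterS n).apply fun _ => idealQSV φ) := d1
  rcases le_total q b with hqb | hqb
  -- Writing `m` for the expectation at `h`, the test value is `2(b m_ρ - q m_φ)`; lower it by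
  -- replacing `q` with `b`, using `m_φ ≥ 0`.
  · have := d2 (-1) (by norm_num)
    have hφ : 0 ≤ (star h ⬝ᵥ φ.op () *ᵥ h).re :=
      (Complex.nonneg_iff.mp ((φ.pos ()).dotProduct_mulVec_nonneg h)).1
    nlinarith [mul_le_mul_of_nonneg_right hqb hφ]
  -- Now the test value is `2b(m_ρ - m_φ) + 2(q - b)(1 - m_φ)`, whose last term is nonnegative.
  · have := d2 1 (by norm_num)
    nlinarith [mul_le_mul_of_nonneg_right hqb (sub_nonneg.mpr hm)]

/-! ### Tensor powers -/

theorem posSemidef_vecMulVec_star {m : Type} [Fintype m] (v : m → ℂ) :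
    (vecMulVec v (star v)).PosSemidef := posSemidef_vecMulVec_self_star v

/-- On the registers in `S`, the tensor power of `A + B` dominates that of `A`. -/
theorem posSemidef_prod_add_sub {n k : ℕ} {A B : Matrix (Fin n) (Fin n) ℂ} (hA : A.PosSemidef)
    (hB : B.PosSemidef) (S : Finset (Fin k)) :
    (Matrix.of fun a b : Fin k → Fin n => ∏ i ∈ S, A (a i) (b i)).PosSemidef ∧
      (Matrix.of fun a b : Fin k → Fin n =>
        ∏ i ∈ S, (A + B) (a i) (b i) - ∏ i ∈ S, A (a i) (b i)).PosSemidef := by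
  induction S using Finset.induction_on with
  | empty =>
    constructor
    · refine (congrArg Matrix.PosSemidef (Matrix.ext fun a b => ?_)).mp
        (posSemidef_vecMulVec_star fun _ : Fin k → Fin n => (1 : ℂ))
      simp [vecMulVec_apply]
    · refine (congrArg Matrix.PosSemidef (Matrix.ext fun a b => ?_)).mp
        (Matrix.PosSemidef.zero (n := Fin k → Fin n) (R := ℂ))
      simp
  | insert i S hi ih =>
    have hs : ∀ {R : Matrix (Fin n) (Fin n) ℂ}, R.PosSemidef →
      (R.submatrix (fun a : Fin k → Fin n => a i) fun a => a i).PosSemidef := fun hR =>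
      hR.submatrix _
    constructor
    · refine (congrArg Matrix.PosSemidef (Matrix.ext fun a b => ?_)).mp ((hs hA).hadamard ih.1)
      simp [Finset.prod_insert hi]
    -- Split the difference as `(A+B)ᵢ (∏(A+B) - ∏A) + Bᵢ ∏A`; both terms are positive by the Schur
    -- product theorem.
    · refine (congrArg Matrix.PosSemidef (Matrix.ext fun a b => ?_)).mp
        (((hs (hA.add hB)).hadamard ih.2).add ((hs hB).hadamard ih.1))
      simp only [Matrix.add_apply, hadamard_apply, submatrix_apply, of_apply,
        Finset.prod_insert hi]
      ring

/-- The mixture `(1 - s) φ + s τ`. -/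
def State.mix {A : Sys} (s : ℝ) (h0 : 0 ≤ s) (h1 : s ≤ 1) (φ τ : State A) : State A where
  op := ((1 - s : ℝ) : ℂ) • φ.op + (s : ℂ) • τ.op
  pos := fun i => ((φ.pos i).smul (Complex.zero_le_real.mpr (sub_nonneg.mpr h1))).add
    ((τ.pos i).smul (Complex.zero_le_real.mpr h0))
  tr_eq_one := by
    have h1 := φ.tr_eq_one
    have h2 := τ.tr_eq_one
    simp only [Sys.tr] at h1 h2 ⊢
    simp only [Pi.add_apply, Pi.smul_apply, trace_add, trace_smul, Finset.sum_add_distrib,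
      ← Finset.smul_sum, h1, h2]
    simp

/-- The power of the mixture dominates `((1-s)φ)^{⊗N}`, and acceptance is monotone. -/
theorem accept_mix_ge {n N : ℕ} (μ : Chan (reg n N) Sys.bit) {s : ℝ} (h0 : 0 ≤ s) (h1 : s ≤ 1)
    (φ τ : State (qudit n)) :
    (1 - s) ^ N * accept μ ((φ.pow N).op ()) ≤
      accept μ (((State.mix s h0 h1 φ τ).pow N).op ()) := by
  have hA : (((1 - s : ℝ) : ℂ) • φ.op ()).PosSemidef :=
    (φ.pos ()).smul (Complex.zero_le_real.mpr (sub_nonneg.mpr h1))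
  have hB : ((s : ℂ) • τ.op ()).PosSemidef := (τ.pos ()).smul (Complex.zero_le_real.mpr h0)
  have hD := (posSemidef_prod_add_sub (k := N) hA hB Finset.univ).2
  have heq : ((State.mix s h0 h1 φ τ).pow N).op () =
      (((1 - s) ^ N : ℝ) : ℂ) • (φ.pow N).op () +
      Matrix.of fun a b : Fin N → Fin n =>
        ∏ i, (((1 - s : ℝ) : ℂ) • φ.op () + (s : ℂ) • τ.op ()) (a i) (b i) -
          ∏ i, (((1 - s : ℝ) : ℂ) • φ.op ()) (a i) (b i) := by
    ext a b
    have : ∏ i, (((1 - s : ℝ) : ℂ) • φ.op ()) (a i) (b i) =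
        (((1 - s) ^ N : ℝ) : ℂ) * ∏ i, φ.op () (a i) (b i) := by
      simp only [Matrix.smul_apply, smul_eq_mul, Finset.prod_mul_distrib, Finset.prod_const,
        Finset.card_univ, Fintype.card_fin, Complex.ofReal_pow]
    change _ = (((1 - s) ^ N : ℝ) : ℂ) * ∏ i, φ.op () (a i) (b i) + (_ - _)
    rw [this, add_sub_cancel]
    rfl
  rw [heq, accept_add, accept_smul]
  exact le_add_of_nonneg_right (accept_nonneg μ hD)

/-! ### Pure states and their acceptance -/

/-- The pure state `|w⟩⟨w|`. -/
def State.pure {n : ℕ} (w : Fin n → ℂ) (hw : star w ⬝ᵥ w = 1) : State (qudit n) where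
  op := fun _ => vecMulVec w (star w)
  pos := fun _ => posSemidef_vecMulVec_star w
  tr_eq_one := by
    refine (Fintype.sum_unique fun _ : Unit => (vecMulVec w (star w)).trace).trans ?_
    rw [trace_vecMulVec, dotProduct_comm, hw]

/-- The vector `v^{⊗k}`. -/
def tensorPow {n : ℕ} (v : Fin n → ℂ) (k : ℕ) : (Fin k → Fin n) → ℂ := fun a => ∏ i, v (a i)

theorem star_tensorPow_dotProduct {n : ℕ} (v w : Fin n → ℂ) (k : ℕ) :
    star (tensorPow v k) ⬝ᵥ tensorPow w k = (star v ⬝ᵥ w) ^ k := by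
  have h := Finset.prod_univ_sum (fun _ : Fin k => (Finset.univ : Finset (Fin n)))
    (fun _ a => star (v a) * w a)
  rw [Fintype.piFinset_univ, Finset.prod_const, Finset.card_univ, Fintype.card_fin] at h
  refine Eq.trans ?_ h.symm
  refine Finset.sum_congr rfl fun a _ => ?_
  rw [Finset.prod_mul_distrib, Pi.star_apply, tensorPow, star_prod, tensorPow]

theorem pow_op_eq_vecMulVec {n : ℕ} (ρ : State (qudit n)) {w : Fin n → ℂ}
    (hw : ρ.op () = vecMulVec w (star w)) (k : ℕ) :
    (ρ.pow k).op () = vecMulVec (tensorPow w k) (star (tensorPow w k)) := by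
  ext a b
  change ∏ i, ρ.op () (a i) (b i) = (∏ i, w (a i)) * star (∏ i, w (b i))
  rw [hw, star_prod, ← Finset.prod_mul_distrib]
  rfl

/-- Decompose `W = γV + R` with `R` orthogonal to `V`, of squared norm `1 - γ²`. Absorbing the cross
terms into a square gives `|W⟩⟨W| ≥ (3/4)γ²|V⟩⟨V| - 3|R⟩⟨R|`. -/
theorem accept_vecMulVec_ge {n N : ℕ} (μ : Chan (reg n N) Sys.bit) {V W : (Fin N → Fin n) → ℂ}
    {γ : ℝ} (hV : star V ⬝ᵥ V = 1) (hW : star W ⬝ᵥ W = 1) (hVW : star V ⬝ᵥ W = γ) :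
    3 / 4 * γ ^ 2 * accept μ (vecMulVec V (star V)) - 3 * (1 - γ ^ 2) ≤
      accept μ (vecMulVec W (star W)) := by
  set R := W - (γ : ℂ) • V with hR
  set Z := ((γ / 2 : ℝ) : ℂ) • V + (2 : ℂ) • R with hZ
  have hWV : star W ⬝ᵥ V = γ := by
    rw [star_dotProduct, hVW]
    simp
  -- `Z` is weighted to have the same cross terms as `W`, since `(γ/2)·2 = γ`; this leaves `γ² -
  -- γ²/4` on `V` and `4 - 1` on `R`.
  have heq : vecMulVec W (star W) + ((3 : ℝ) : ℂ) • vecMulVec R (star R) =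
      ((3 / 4 * γ ^ 2 : ℝ) : ℂ) • vecMulVec V (star V) + vecMulVec Z (star Z) := by
    ext a b
    simp only [hZ, hR, Matrix.add_apply, Matrix.smul_apply, vecMulVec_apply, Pi.star_apply,
      Pi.add_apply, Pi.sub_apply, Pi.smul_apply, smul_eq_mul, star_add, star_sub, star_mul',
      Complex.star_def, Complex.conj_ofReal, map_ofNat]
    push_cast
    ring
  have hRR : (vecMulVec R (star R)).trace.re = 1 - γ ^ 2 := by
    rw [trace_vecMulVec, dotProduct_comm, hR, star_sub, star_smul, sub_dotProduct,
      dotProduct_sub, dotProduct_sub, smul_dotProduct, smul_dotProduct, dotProduct_smul,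
      dotProduct_smul, hW, hV, hVW, hWV]
    have : (1 - (γ : ℂ) • (γ : ℂ) - (star (γ : ℂ) • (γ : ℂ) - star (γ : ℂ) • (γ : ℂ) • (1 : ℂ))) =
        ((1 - γ ^ 2 : ℝ) : ℂ) := by
      simp only [Complex.star_def, Complex.conj_ofReal, smul_eq_mul]
      push_cast
      ring
    rw [this, Complex.ofReal_re]
  have h := congrArg (accept μ) heq
  rw [accept_add, accept_add, accept_smul, accept_smul] at h
  have h1 := accept_nonneg μ (posSemidef_vecMulVec_star Z)
  have h2 := accept_le_trace μ (posSemidef_vecMulVec_star R)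
  rw [hRR] at h2
  linarith

theorem exists_unit_orthogonal {n : ℕ} (hn : 2 ≤ n) (v : Fin n → ℂ) :
    ∃ u : Fin n → ℂ, star u ⬝ᵥ u = 1 ∧ star u ⬝ᵥ v = 0 ∧ star v ⬝ᵥ u = 0 := by
  have hker := LinearMap.ker_ne_bot_of_finrank_lt
    (f := (Matrix.of fun _ : Fin 1 => star v).mulVecLin) (by simpa using (show 1 < n from hn))
  obtain ⟨x, hx, hx0⟩ := (Submodule.ne_bot_iff _).mp hker
  have hvx : star v ⬝ᵥ x = 0 := congrFun (LinearMap.mem_ker.mp hx) 0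
  have hxv : star x ⬝ᵥ v = 0 := by
    rw [star_dotProduct, hvx, star_zero]
  have hpos : 0 ≤ star x ⬝ᵥ x := dotProduct_star_self_nonneg x
  have hne : star x ⬝ᵥ x ≠ 0 := fun h => hx0 (dotProduct_star_self_eq_zero.mp h)
  have hr : star x ⬝ᵥ x = ((star x ⬝ᵥ x).re : ℂ) := Complex.eq_re_of_ofReal_le hpos
  set r := (star x ⬝ᵥ x).re
  have hr0 : 0 ≤ r := (Complex.nonneg_iff.mp hpos).1
  have hr1 : r ≠ 0 := fun h => hne (by rw [hr, h, Complex.ofReal_zero])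
  refine ⟨((√r)⁻¹ : ℂ) • x, ?_, ?_, ?_⟩
  · rw [star_smul, smul_dotProduct, dotProduct_smul, hr]
    simp only [smul_eq_mul, star_inv₀, Complex.star_def, Complex.conj_ofReal]
    rw [← Complex.ofReal_inv, ← Complex.ofReal_mul, ← Complex.ofReal_mul, ← mul_assoc, ← mul_inv,
      Real.mul_self_sqrt hr0, inv_mul_cancel₀ hr1, Complex.ofReal_one]
  · rw [star_smul, smul_dotProduct, hxv, smul_zero]
  · rw [dotProduct_smul, hvx, smul_zero]

/-- The `n ≥ 2` diagonal entries sum to one. -/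
theorem exists_diag_le_half {n : ℕ} (hn : 2 ≤ n) (φ : State (qudit n)) :
    ∃ j, (φ.op () j j).re ≤ 1 / 2 := by
  by_contra! hc
  have h := congrArg Complex.re φ.trace_eq_one
  rw [trace, Complex.re_sum, Complex.one_re] at h
  have : ∑ _j : Fin n, (1 / 2 : ℝ) < ∑ j, (diag (φ.op ()) j).re :=
    Finset.sum_lt_sum_of_nonempty ⟨⟨0, by omega⟩, Finset.mem_univ _⟩ fun j _ => hc j
  rw [h, Finset.sum_const, Finset.card_univ, Fintype.card_fin, nsmul_eq_mul] at this
  have : (2 : ℝ) ≤ n := by exact_mod_cast hn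
  linarith

theorem re_star_dotProduct_vecMulVec_mulVec {n : ℕ} {h w : Fin n → ℂ} {c : ℝ}
    (hc : star h ⬝ᵥ w = c) : (star h ⬝ᵥ vecMulVec w (star w) *ᵥ h).re = c ^ 2 := by
  have hc' : star w ⬝ᵥ h = c := by
    rw [star_dotProduct, hc]
    simp
  rw [vecMulVec_mulVec, hc', dotProduct_smul, hc]
  change (((c : ℂ)) * (c : ℂ)).re = c ^ 2
  rw [← Complex.ofReal_mul, Complex.ofReal_re, sq]

/-! ### The two attacks -/

theorem mixed_attack_bound {n N : ℕ} (hn : 2 ≤ n) (hN : 1 ≤ N) (φ : State (qudit n))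
    (μ : Chan (reg n N) Sys.bit) :
    ∃ (ρ : State (qudit n)) (h : Fin n → ℂ), star h ⬝ᵥ h = 1 ∧
      (star h ⬝ᵥ φ.op () *ᵥ h).re ≤ 1 ∧
      1 / (27 * (N : ℝ)) ≤ 1 - accept μ ((φ.pow N).op ()) + accept μ ((ρ.pow N).op ()) *
        ((star h ⬝ᵥ ρ.op () *ᵥ h).re - (star h ⬝ᵥ φ.op () *ᵥ h).re) := by
  obtain ⟨j, hj⟩ := exists_diag_le_half hn φ
  have hN' : (1 : ℝ) ≤ N := by exact_mod_cast hN
  -- Small enough that Bernoulli gives `(1 - s)^N ≥ 1 - sN = 1/2`.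
  set s : ℝ := 1 / (2 * N) with hs
  have hsN : s * N = 1 / 2 := by rw [hs]; field_simp
  have hs0 : 0 ≤ s := by positivity
  have hs1 : s ≤ 1 / 2 := by nlinarith
  have hh : star (Pi.single j (1 : ℂ) : Fin n → ℂ) ⬝ᵥ Pi.single j 1 = 1 := by simp
  have hm : ∀ σ : State (qudit n), (star (Pi.single j (1 : ℂ) : Fin n → ℂ) ⬝ᵥ
      σ.op () *ᵥ Pi.single j 1) = σ.op () j j := fun σ => by
    simp
  refine ⟨State.mix s hs0 (by linarith) φ (State.pure (Pi.single j 1) hh), Pi.single j 1, hh, ?_, ?_⟩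
  · rw [hm]
    linarith
  · have hρ : ((State.mix s hs0 (by linarith) φ (State.pure (Pi.single j 1) hh)).op () j j).re =
        (1 - s) * (φ.op () j j).re + s := by
      change ((((1 - s : ℝ) : ℂ)) * φ.op () j j + (s : ℂ) * (vecMulVec (Pi.single j (1 : ℂ))
        (star (Pi.single j (1 : ℂ))) j j)).re = _
      simp [vecMulVec_apply]
    rw [hm, hm, hρ]
    have hacc := accept_mix_ge μ hs0 (by linarith) φ (State.pure (Pi.single j 1) hh)
    obtain ⟨-, -, a0, a1⟩ := bitVal_pow μ φ
    set a := accept μ ((φ.pow N).op ())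
    have hb : 1 / 2 ≤ (1 - s) ^ N := by
      have := one_add_mul_le_pow (a := -s) (by linarith) N
      rw [← sub_eq_add_neg] at this
      linarith
    have ha : 1 / 2 * a ≤ accept μ (((State.mix s hs0 (by linarith) φ
      (State.pure (Pi.single j 1) hh)).pow N).op ()) :=
      (mul_le_mul_of_nonneg_right hb a0).trans hacc
    have hd : s / 2 ≤ (1 - s) * (φ.op () j j).re + s - (φ.op () j j).re := by nlinarith
    -- The argument yields `1 - a + as/4 ≥ s/4 = 1/(8N)`, more than required.
    have hε : 1 / (27 * (N : ℝ)) ≤ s / 4 := by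
      rw [hs, div_div, div_le_div_iff₀ (by positivity) (by positivity)]
      linarith
    have := mul_le_mul ha hd (by positivity) (le_trans (by positivity) ha)
    nlinarith

theorem pure_attack_bound {n N : ℕ} (hn : 2 ≤ n) (hN : 1 ≤ N) (φ : State (qudit n))
    (hφ : φ.IsPure) (μ : Chan (reg n N) Sys.bit) :
    ∃ (ρ : State (qudit n)) (h : Fin n → ℂ), star h ⬝ᵥ h = 1 ∧
      (star h ⬝ᵥ φ.op () *ᵥ h).re ≤ 1 ∧
      1 / (8 * √(N : ℝ)) ≤ 1 - accept μ ((φ.pow N).op ()) + accept μ ((ρ.pow N).op ()) *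
        ((star h ⬝ᵥ ρ.op () *ᵥ h).re - (star h ⬝ᵥ φ.op () *ᵥ h).re) := by
  obtain ⟨v, hvv, hφv⟩ := hφ
  obtain ⟨u, huu, huv, hvu⟩ := exists_unit_orthogonal hn v
  have hN' : (1 : ℝ) ≤ N := by exact_mod_cast hN
  have hsq : 1 ≤ √(N : ℝ) := Real.one_le_sqrt.mpr hN'
  -- `t` is the sine of the angle between `v` and the rotated vector `w`; its size gives `(1 - t²)^N
  -- ≥ 1 - Nt² = 15/16`.
  set t : ℝ := 1 / (4 * √(N : ℝ)) with ht
  have ht0 : 0 < t := by positivity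
  have htN : t ^ 2 * N = 1 / 16 := by
    rw [ht, div_pow, mul_pow, Real.sq_sqrt (by linarith)]
    field_simp
    norm_num
  have ht1 : t ≤ 1 / 4 := by
    rw [ht, div_le_div_iff₀ (by positivity) (by norm_num)]
    linarith
  -- These make `h = αv + βu` the eigenvector of `|w⟩⟨w| - |v⟩⟨v|` with eigenvalue `t`, hence the
  -- best test vector. The cosine of the angle is `2αβ`.
  set α : ℝ := √((1 - t) / 2)
  set β : ℝ := √((1 + t) / 2)
  have hα : α ^ 2 = (1 - t) / 2 := Real.sq_sqrt (by linarith)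
  have hβ : β ^ 2 = (1 + t) / 2 := Real.sq_sqrt (by linarith)
  have hcomb : ∀ x y x' y' : ℝ, star ((x : ℂ) • v + (y : ℂ) • u) ⬝ᵥ
      ((x' : ℂ) • v + (y' : ℂ) • u) = ((x * x' + y * y' : ℝ) : ℂ) := by
    intro x y x' y'
    simp only [star_add, star_smul, add_dotProduct, dotProduct_add, smul_dotProduct,
      dotProduct_smul, hvv, huu, huv, hvu, smul_eq_mul, Complex.star_def, Complex.conj_ofReal]
    push_cast
    ring
  set w := ((2 * α * β : ℝ) : ℂ) • v + (t : ℂ) • u with hw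
  set h := (α : ℂ) • v + (β : ℂ) • u with hh
  -- Brings `v` into the form that `hcomb` handles.
  have hv : v = ((1 : ℝ) : ℂ) • v + ((0 : ℝ) : ℂ) • u := by simp
  have hc2 : (2 * α * β) ^ 2 = 1 - t ^ 2 := by
    rw [mul_pow, mul_pow, hα, hβ]
    ring
  have hww : star w ⬝ᵥ w = 1 := by
    rw [hw, hcomb, ← Complex.ofReal_one]
    congr 1
    linear_combination hc2
  have hvw : star v ⬝ᵥ w = ((2 * α * β : ℝ) : ℂ) := by
    conv_lhs => rw [hv]
    rw [hw, hcomb]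
    congr 1
    ring
  have hhv : star h ⬝ᵥ v = (α : ℂ) := by
    conv_lhs => rw [hv]
    rw [hh, hcomb]
    congr 1
    ring
  have hhw : star h ⬝ᵥ w = ((α * (2 * α * β) + β * t : ℝ) : ℂ) := by
    rw [hw, hh, hcomb]
  have mφ : (star h ⬝ᵥ φ.op () *ᵥ h).re = (1 - t) / 2 := by
    rw [hφv, re_star_dotProduct_vecMulVec_mulVec hhv, hα]
  have mρ : (star h ⬝ᵥ (State.pure w hww).op () *ᵥ h).re = (1 + t) / 2 := by
    refine (re_star_dotProduct_vecMulVec_mulVec hhw).trans ?_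
    have : α * (2 * α * β) + β * t = β := by linear_combination 2 * β * hα
    rw [this, hβ]
  refine ⟨State.pure w hww, h, ?_, ?_, ?_⟩
  · rw [hh, hcomb, ← Complex.ofReal_one]
    congr 1
    linear_combination hα + hβ
  · rw [mφ]
    linarith
  · rw [mφ, mρ]
    have hacc := accept_vecMulVec_ge μ (V := tensorPow v N) (W := tensorPow w N)
      (γ := (2 * α * β) ^ N) (by rw [star_tensorPow_dotProduct, hvv, one_pow])
      (by rw [star_tensorPow_dotProduct, hww, one_pow])
      (by rw [star_tensorPow_dotProduct, hvw, Complex.ofReal_pow])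
    rw [← pow_op_eq_vecMulVec φ hφv, ← pow_op_eq_vecMulVec (State.pure w hww) rfl, ← pow_mul,
      mul_comm N 2, pow_mul, hc2] at hacc
    obtain ⟨-, -, a0, a1⟩ := bitVal_pow μ φ
    set a := accept μ ((φ.pow N).op ())
    set b := accept μ (((State.pure w hww).pow N).op ())
    have hx : 15 / 16 ≤ (1 - t ^ 2) ^ N := by
      have := one_add_mul_le_pow (a := -t ^ 2) (by nlinarith) N
      rw [← sub_eq_add_neg] at this
      linarith
    have hb : 45 / 64 * a - 12 / 64 ≤ b := by nlinarith
    have hε : 1 / (8 * √(N : ℝ)) = t / 2 := by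
      rw [ht, div_div]
      ring
    rw [hε]
    -- The lower bound `1 - a + t(45a - 12)/64` decreases in `a`, and at `a = 1` equals `33t/64 ≥
    -- t/2`.
    nlinarith [mul_le_mul_of_nonneg_right hb ht0.le,
      mul_nonneg (sub_nonneg.mpr a1) (sub_nonneg.mpr ht1)]

end QSV
end

theorem theorem1 (n N : ℕ) (hn : 2 ≤ n) (hN : 1 ≤ N) (φ : QSV.State (QSV.qudit n))
    (η : QSV.State (QSV.Sys.copies (N + 1) QSV.Sys.unit))
    (μ : QSV.Chan (QSV.reg n N) QSV.Sys.bit) (ε : ℝ)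
    (hε : (φ.IsPure ∧ ε = 1 / (8 * √(N : ℝ))) ∨ (¬ φ.IsPure ∧ ε = 1 / (27 * (N : ℝ)))) :
    ∃ ρ : QSV.State (QSV.qudit n),
      QSV.iidAttack φ η μ ρ ∈
        QSV.attacks (QSV.simpleProtocol φ η μ) QSV.Sys.unit QSV.Sys.unit ∧
      ∀ B ∈ QSV.attacks (QSV.Protocol.id (QSV.idealType n)) QSV.Sys.unit QSV.Sys.unit,
        ε ≤
          1 / 2 * QSV.diamondDist
              ((QSV.simpleProtocol φ η μ).apply fun _ => QSV.quantumChannel n)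
              ((QSV.filterS n).apply fun _ => QSV.idealQSV φ) +
          1 / 2 * QSV.diamondDist
              ((QSV.iidAttack φ η μ ρ).apply fun _ => QSV.quantumChannel n)
              (B.apply fun _ => QSV.idealQSV φ) := by
  rcases hε with ⟨hφ, rfl⟩ | ⟨-, rfl⟩
  · obtain ⟨ρ, h, hh, hm, hle⟩ := QSV.pure_attack_bound hn hN φ hφ μ
    exact ⟨ρ, ⟨QSV.copiesComb N ρ, rfl⟩, fun B hB =>
      hle.trans (QSV.le_half_diamondDist_add φ η μ ρ hh hm B hB)⟩
  · obtain ⟨ρ, h, hh, hm, hle⟩ := QSV.mixed_attack_bound hn hN φ μ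
    exact ⟨ρ, ⟨QSV.copiesComb N ρ, rfl⟩, fun B hB =>
      hle.trans (QSV.le_half_diamondDist_add φ η μ ρ hh hm B hB)⟩
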